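/- **The renormalized multi-processor cup game.** There are $n$ cups, initially empty, and $p\ge 1$ processors; $0<\varepsilon\le 1/2$ and $0<\delta<1$ are parameters. In each step $i=1,2,\dots$ the filler pours an amount $c_j(i)\in[0,1]$ of water into each cup $j$, with $\sum_j c_j(i)\le(1-\varepsilon)p$; then the emptier selects up to $p+1$ distinct cups and removes up to $1+2\delta$ units of water from each. The filler is oblivious: all the $c_j(i)$ are fixed before the game starts. The *backlog* after step $i$ is the amount of water in the fullest cup at that time. **The multi-processor smoothed greedy algorithm.** Suppose first that $1/\delta$ is an integer. For every cup $j$ and every natural number $\kappa\equiv 1 \pmod{1/\delta+1}$ the emptier draws a value $s_j(\kappa)$ uniformly from $(0,1]$, all of these values being independent, and puts thresholds in cup $j$ at $\kappa+u+s_j(\kappa)$ for $u=1,\dots,1/\delta$. Let $a_j(i)$ be the total amount of water poured into cup $j$ in the first $i$ steps. Cup $j$ *crosses a threshold* in step $i$ if it has a threshold $r$ with $a_j(i-1)<r\le a_j(i)$. Each cup has a counter $w_j$, initially $0$, which is increased by $1+\delta$ whenever the cup crosses a threshold. In each step, after the water has been poured and the counters have been increased, the emptier selects $p+1$ cups (all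 cups if $n<p+1$), giving priority to the cups with $w_j\ge 1+\delta$ over all others, then to the cups with $w_j\ne 0$ over those with $w_j=0$, and within each of these three levels to the fullest cups, with ties broken arbitrarily. From each selected cup $j$ the emptier removes $\min(1+2\delta,w_j)$ units of water, and decreases $w_j$ by the same amount. If $1/\delta$ is not an integer, the emptier runs this algorithm with $1/\lceil 1/\delta\rceil$ in the place of $\delta$. **Theorem.** There are absolute constants $c_0,C_0>0$ such that for every $a\in\mathbb N$ there are constants $B,D>0$, depending only on $a$, with the following property. Let $n\in\mathbb N$, $p\ge1$, and suppose that $$p^{-1/3}\le\varepsilon\le\tfrac12,\qquad \delta\ge p^{-a},\qquad C_0\,e^{-c_0\varepsilon^2p}\le\delta<1 .$$ Then, for every oblivious filler in the renormalized multi-processor cup game on $n$ cups, for every step $i$ and every real $k\ge\log p$, the multi-processor smoothed greedy algorithm has backlog at most $B\,k/\varepsilon$ after step $i$ with probability at least $$1-D\,e^{-e^{k}} .$$ -/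

import Mathlib

open MeasureTheory ProbabilityTheory

noncomputable section

namespace CupGame

/-- An (oblivious) pouring schedule for the renormalized `p`-processor cup game on `n` cups:
`c i j` is the amount of water poured into cup `j` during the `(i+1)`-st step.  At most one unit
goes into each cup, and at most `(1 - ε) p` units are poured in total, at each step. -/
structure IsPouring (n p : ℕ) (ε : ℝ) (c : ℕ → Fin n → ℝ) : Prop where
  nonneg : ∀ i j, 0 ≤ c i j
  le_one : ∀ i j, c i j ≤ 1
  sum_le : ∀ i, ∑ j, c i j ≤ (1 - ε) * p

/-- The total amount of water poured into cup `j` during the first `i` steps. -/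
def poured {n : ℕ} (c : ℕ → Fin n → ℝ) (i : ℕ) (j : Fin n) : ℝ :=
  ∑ t ∈ Finset.range i, c t j

/-- Let `d = 1/δ`, and let `s m` be the random value of the `m`-th threshold collection of a cup
(`m = 0, 1, 2, …`).  With `κ = m (d + 1) + 1`, so that `κ` runs through the natural numbers
congruent to `1` modulo `d + 1`, that collection consists of the thresholds `(κ + u) + s m` for
`1 ≤ u ≤ d`.  There is no threshold attached to the index `κ` itself, nor to the index `0`. -/
def threshold (d : ℕ) (s : ℕ → ℝ) (m u : ℕ) : ℝ :=
  ((m * (d + 1) + 1 + u : ℕ) : ℝ) + s m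

/-- Some threshold lies in `(x, y]`: a cup into which a total of `x` units had been poured before
a step, and a total of `y` units after it, crosses a threshold during that step. -/
def Crosses (d : ℕ) (s : ℕ → ℝ) (x y : ℝ) : Prop :=
  ∃ m u : ℕ, 1 ≤ u ∧ u ≤ d ∧ x < threshold d s m u ∧ threshold d s m u ≤ y

/-- The state of the cups: the amount of water `fill j` in each cup `j`, and the threshold counter
`counter j` which the algorithm keeps for it. -/
structure State (n : ℕ) where
  fill : Fin n → ℝ
  counter : Fin n → ℝ

open Classical in
/-- The filler's part of the `(i+1)`-st step: the water is poured, and the counter of each cup that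
crosses a threshold is increased by `1 + δ = 1 + 1/d`. -/
def afterPour {n : ℕ} (d : ℕ) (c : ℕ → Fin n → ℝ) (s : Fin n → ℕ → ℝ) (i : ℕ) (st : State n) :
    State n where
  fill j := st.fill j + c i j
  counter j := st.counter j +
    if Crosses d (s j) (poured c i j) (poured c (i + 1) j) then 1 + 1 / (d : ℝ) else 0

/-- The amount taken out of cup `j` when the set `S` of cups is selected: `min (1 + 2δ) (w j)` with
`δ = 1/d` if `j ∈ S`, where `w` is the counter, and nothing otherwise. -/
def removed {n : ℕ} (d : ℕ) (S : Finset (Fin n)) (st : State n) (j : Fin n) : ℝ :=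
  if j ∈ S then min (1 + 2 / (d : ℝ)) (st.counter j) else 0

/-- The emptier's part of a step.  The same amount is subtracted from the fill and from the counter
(the counter never exceeds the fill in a run of the game, so the water is there). -/
def afterEmpty {n : ℕ} (d : ℕ) (S : Finset (Fin n)) (st : State n) : State n where
  fill j := st.fill j - removed d S st j
  counter j := st.counter j - removed d S st j

/-- The state after the first `i` steps, where `S i` is the set of cups that the emptier selects in
the `(i+1)`-st step.  All cups are empty and all counters are zero at the beginning. -/
def state {n : ℕ} (d : ℕ) (c : ℕ → Fin n → ℝ) (s : Fin n → ℕ → ℝ) (S : ℕ → Finset (Fin n)) :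
    ℕ → State n
  | 0 => ⟨fun _ => 0, fun _ => 0⟩
  | i + 1 => afterEmpty d (S i) (afterPour d c s i (state d c s S i))

open Classical in
/-- The priority level of a cup with counter `w`: cups with `w ≥ 1 + δ` come first, then the other
cups with `w ≠ 0`, then the cups with `w = 0`. -/
def level (d : ℕ) (w : ℝ) : ℕ :=
  if 1 + 1 / (d : ℝ) ≤ w then 2 else if w ≠ 0 then 1 else 0

/-- `S` consists of `p + 1` cups (of all cups if there are fewer), chosen by priority level, and
by fill within a level, fullest cups first.  Ties may be broken in any way. -/
def IsGreedyChoice {n : ℕ} (p d : ℕ) (st : State n) (S : Finset (Fin n)) : Prop :=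
  S.card = min (p + 1) n ∧
  ∀ j ∈ S, ∀ j' ∉ S,
    level d (st.counter j') < level d (st.counter j) ∨
      (level d (st.counter j') = level d (st.counter j) ∧ st.fill j' ≤ st.fill j)

/-- The emptier follows the multi-processor smoothed greedy algorithm with parameter `δ = 1/d`,
with `s j m` as the random value of the `m`-th threshold collection of cup `j`: each of the sets
`S i` is a greedy choice with respect to the fills and the counters after the pouring. -/
def IsSmoothedGreedy {n : ℕ} (p d : ℕ) (c : ℕ → Fin n → ℝ) (s : Fin n → ℕ → ℝ)
    (S : ℕ → Finset (Fin n)) : Prop :=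
  ∀ i, IsGreedyChoice p d (afterPour d c s i (state d c s S i)) (S i)

/-- The amount of water in the fullest cup. -/
def backlog {n : ℕ} (st : State n) : ℝ := ⨆ j, st.fill j

end CupGame

end

/-! Two quantities are tracked: `potential`, an exponential sum over fills above 5, and `work`, the
number of whole jobs of size `1 + 1/d` left in the counters. Thresholds have average spacing `1 +
1/d`, so fill and counter of a cup always agree up to a constant (`abs_fill_sub_counter`). A step is
busy if at least `p + 1` cups are heavy after the pouring, and idle otherwise.

Deterministic part. In a busy step the `p + 1` selected cups outweigh the at most `(1 - ε) p` units
poured, so the potential grows by at most `K = maxIncrease p ε`. In an idle step every cup that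
counts is selected and loses `2/d` net, so the potential contracts, dropping by `4 K` when it
remains above `plateau`. Hence a potential above `plateau + K L` forces a window of length at least
`L`, ending now, in which over four fifths of the steps are busy. Each busy step completes `p + 1`
jobs, idle steps do not increase the work, and the work at the start of the window is bounded. Since
the work stays nonnegative, the crossings must exceed `(1 - ε/2) p` per step by a total of at least
`ε p ℓ / 4` over the window, `ℓ` being its length (`exists_excess_window`).

Probabilistic part. The crossings depend only on the oblivious pouring and the independent values `s
j m`, not on the emptier's choices. Their expected number per step is at most `(1 - ε) p`, so the
expected excess is at most `4/ε`, which is at most `ε p / 8` once `ε² p ≥ 32`. One value `s j m`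
changes the total excess by at most `d`, and matters with small probability; a Bernstein-type bound
gives probability at most `exp (-ℓ / (8 d²))` for each window (`measureReal_excess_le`). Summing
over the windows ending now costs only a factor of order `d²` and half of the exponent. With `y =
e^k`, taking `L` a power of `y` makes the tail `O(e^{-y})` while the potential stays polynomial in
`y`, so fills are `O(k/ε)`. -/

noncomputable section

namespace CupGame

/-! ### Threshold positions and the number of crossings -/

/-- The thresholds of a cup in increasing order. -/
def sortedThreshold (d : ℕ) (s : ℕ → ℝ) (r : ℕ) : ℝ :=
  threshold d s (r / d) (r % d + 1)

lemma sortedThreshold_eq (d : ℕ) (s : ℕ → ℝ) (r : ℕ) :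
    sortedThreshold d s r = r + (r / d : ℕ) + 2 + s (r / d) := by
  have h : r / d * (d + 1) + 1 + (r % d + 1) = r + r / d + 2 := by
    have := Nat.div_add_mod r d
    linarith [this, mul_comm d (r / d)]
  rw [sortedThreshold, threshold, h]
  push_cast
  ring

lemma threshold_eq_sortedThreshold {d : ℕ} (s : ℕ → ℝ) (m : ℕ) {u : ℕ} (h1 : 1 ≤ u)
    (hd : u ≤ d) : threshold d s m u = sortedThreshold d s (m * d + (u - 1)) := by
  have hlt : u - 1 < d := by omega
  have h2 : (m * d + (u - 1)) / d = m := by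
    rw [add_comm, Nat.add_mul_div_right _ _ (by omega), Nat.div_eq_of_lt hlt, zero_add]
  have h3 : (m * d + (u - 1)) % d = u - 1 := by
    rw [add_comm, Nat.add_mul_mod_self_right, Nat.mod_eq_of_lt hlt]
  rw [sortedThreshold, h2, h3, Nat.sub_add_cancel h1]

lemma crosses_iff {d : ℕ} (hd : 0 < d) (s : ℕ → ℝ) (x y : ℝ) :
    Crosses d s x y ↔ ∃ r, x < sortedThreshold d s r ∧ sortedThreshold d s r ≤ y := by
  constructor
  · rintro ⟨m, u, h1, h2, h3, h4⟩
    rw [threshold_eq_sortedThreshold s m h1 h2] at h3 h4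
    exact ⟨_, h3, h4⟩
  · rintro ⟨r, h3, h4⟩
    exact ⟨r / d, r % d + 1, by omega, Nat.mod_lt r hd, h3, h4⟩

/-- Within a collection the gap is exactly 1. Between collections the omitted index makes the
integer parts differ by 2, which absorbs any change of the random offset. -/
lemma sortedThreshold_succ {d : ℕ} {s : ℕ → ℝ} (hs : ∀ m, 0 < s m ∧ s m ≤ 1) (r : ℕ) :
    sortedThreshold d s r + 1 ≤ sortedThreshold d s (r + 1) := by
  rw [sortedThreshold_eq, sortedThreshold_eq]
  have hmono : r / d ≤ (r + 1) / d := Nat.div_le_div_right (Nat.le_succ r)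
  rcases hmono.eq_or_lt with h | h
  · rw [← h]; push_cast; linarith
  · have h' : ((r / d : ℕ) : ℝ) + 1 ≤ ((r + 1) / d : ℕ) := by exact_mod_cast h
    push_cast at h' ⊢
    linarith [(hs (r / d)).2, (hs ((r + 1) / d)).1]

lemma sortedThreshold_mono {d : ℕ} {s : ℕ → ℝ} (hs : ∀ m, 0 < s m ∧ s m ≤ 1) :
    Monotone (sortedThreshold d s) :=
  monotone_nat_of_le_succ fun r => by linarith [sortedThreshold_succ (d := d) hs r]

open Classical in
/-- The number of the first `i` steps in which a cup crosses a threshold, if `a t` is the total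
amount poured into it during the first `t` steps. -/
def crossings (d : ℕ) (s : ℕ → ℝ) (a : ℕ → ℝ) (i : ℕ) : ℕ :=
  ∑ t ∈ Finset.range i, if Crosses d s (a t) (a (t + 1)) then 1 else 0

/-- A step pours at most 1 and thresholds are at least 1 apart, so no step passes two of them:
counting crossing steps counts thresholds passed. -/
lemma sortedThreshold_crossings {d : ℕ} (hd : 0 < d) {s : ℕ → ℝ} (hs : ∀ m, 0 < s m ∧ s m ≤ 1)
    {a : ℕ → ℝ} (h0 : a 0 = 0) (hmono : Monotone a) (hstep : ∀ i, a (i + 1) ≤ a i + 1) (i : ℕ) :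
    (∀ q < crossings d s a i, sortedThreshold d s q ≤ a i) ∧
      a i < sortedThreshold d s (crossings d s a i) := by
  induction i with
  | zero =>
    simp only [crossings, Finset.range_zero, Finset.sum_empty, sortedThreshold_eq, h0]
    refine ⟨fun q hq => absurd hq (Nat.not_lt_zero q), ?_⟩
    have := (hs (0 / d)).1
    positivity
  | succ i ih =>
    obtain ⟨h1, h2⟩ := ih
    have hrec : crossings d s a (i + 1) = crossings d s a i + _ := Finset.sum_range_succ _ _
    by_cases hc : Crosses d s (a i) (a (i + 1))
    · rw [if_pos hc] at hrec
      rw [hrec]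
      obtain ⟨q, hq1, hq2⟩ := (crosses_iff hd _ _ _).1 hc
      have hq : crossings d s a i ≤ q := by
        by_contra! hlt
        exact absurd (h1 q hlt) (not_le.2 hq1)
      have hle := (sortedThreshold_mono hs hq).trans hq2
      refine ⟨fun r hr => ?_, ?_⟩
      · exact (sortedThreshold_mono hs (Nat.lt_succ_iff.1 hr)).trans hle
      · linarith [sortedThreshold_succ (d := d) hs (crossings d s a i), hstep i]
    · rw [if_neg hc, add_zero] at hrec
      rw [hrec]
      refine ⟨fun q hq => (h1 q hq).trans (hmono (Nat.le_succ i)), ?_⟩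
      by_contra! hle
      exact hc ((crosses_iff hd _ _ _).2 ⟨_, h2, hle⟩)

/-- The amount poured lies between the last threshold passed and the next one, and the `r`-th
threshold is `(1 + 1/d) r` up to a bounded error. -/
lemma poured_sub_crossings {d : ℕ} (hd : 0 < d) {s : ℕ → ℝ} (hs : ∀ m, 0 < s m ∧ s m ≤ 1)
    {a : ℕ → ℝ} (h0 : a 0 = 0) (hmono : Monotone a) (hstep : ∀ i, a (i + 1) ≤ a i + 1) (i : ℕ) :
    -1 ≤ a i - (1 + 1 / (d : ℝ)) * crossings d s a i ∧
      a i - (1 + 1 / (d : ℝ)) * crossings d s a i ≤ 3 := by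
  obtain ⟨h1, h2⟩ := sortedThreshold_crossings hd hs h0 hmono hstep i
  have hd' : (1 : ℝ) ≤ d := by exact_mod_cast hd
  have hd1 : 1 / (d : ℝ) ≤ 1 := by rw [div_le_one (by linarith)]; exact hd'
  generalize crossings d s a i = r at *
  constructor
  · rcases Nat.eq_zero_or_pos r with rfl | hr
    · have := hmono (Nat.zero_le i)
      simp only [Nat.cast_zero, mul_zero]
      linarith
    · have h3 := h1 (r - 1) (by omega)
      rw [sortedThreshold_eq] at h3
      have h4 := (hs ((r - 1) / d)).1
      have h5 : ((r - 1 : ℕ) : ℝ) / d < ((r - 1) / d : ℕ) + 1 := by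
        rw [div_lt_iff₀ (by linarith)]
        exact_mod_cast Nat.lt_div_mul_add hd |>.trans_eq (by ring)
      rw [Nat.cast_sub hr] at h3 h5
      push_cast at h3 h5
      have : (1 + 1 / (d : ℝ)) * r = r + ((r : ℝ) - 1) / d + 1 / d := by ring
      linarith
  · rw [sortedThreshold_eq] at h2
    have h4 := (hs (r / d)).2
    have h5 : ((r / d : ℕ) : ℝ) ≤ r / d := Nat.cast_div_le
    have : (1 + 1 / (d : ℝ)) * r = r + (r : ℝ) / d := by ring
    linarith

/-! ### Fills and counters during a run -/

section Run

variable {n : ℕ} (d : ℕ) (c : ℕ → Fin n → ℝ) (s : Fin n → ℕ → ℝ) (S : ℕ → Finset (Fin n))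

/-- The state in the middle of the `(i+1)`-st step, after the pouring. -/
def midState (i : ℕ) : State n := afterPour d c s i (state d c s S i)

lemma state_succ (i : ℕ) :
    state d c s S (i + 1) = afterEmpty d (S i) (midState d c s S i) := rfl

lemma midState_fill (i : ℕ) (j : Fin n) :
    (midState d c s S i).fill j = (state d c s S i).fill j + c i j := rfl

lemma poured_zero (j : Fin n) : poured c 0 j = 0 := by simp [poured]

lemma poured_succ (i : ℕ) (j : Fin n) : poured c (i + 1) j = poured c i j + c i j :=
  Finset.sum_range_succ _ _

lemma removed_nonneg {T : Finset (Fin n)} {st : State n} {j : Fin n} (h : 0 ≤ st.counter j) :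
    0 ≤ removed d T st j := by
  unfold removed
  split_ifs
  · exact le_min (by positivity) h
  · exact le_rfl

lemma removed_le {T : Finset (Fin n)} {st : State n} {j : Fin n} (h : 0 ≤ st.counter j) :
    removed d T st j ≤ st.counter j := by
  unfold removed
  split_ifs
  · exact min_le_right _ _
  · exact h

lemma counter_nonneg (i : ℕ) (j : Fin n) :
    0 ≤ (state d c s S i).counter j ∧ 0 ≤ (midState d c s S i).counter j := by
  have key : ∀ i, 0 ≤ (state d c s S i).counter j → 0 ≤ (midState d c s S i).counter j := by
    intro i h
    refine add_nonneg h ?_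
    split_ifs <;> positivity
  have : ∀ i, 0 ≤ (state d c s S i).counter j := by
    intro i
    induction i with
    | zero => exact le_rfl
    | succ i ih =>
      exact sub_nonneg.2 (removed_le d (key i ih))
  exact ⟨this i, key i (this i)⟩

lemma fill_sub_counter (i : ℕ) (j : Fin n) :
    (state d c s S i).fill j - (state d c s S i).counter j =
      poured c i j - (1 + 1 / (d : ℝ)) * crossings d (s j) (fun t => poured c t j) i := by
  induction i with
  | zero => simp [state, poured, crossings]
  | succ i ih =>
    have hrec : crossings d (s j) (fun t => poured c t j) (i + 1) =
      crossings d (s j) (fun t => poured c t j) i + _ := Finset.sum_range_succ _ _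
    rw [hrec, poured_succ]
    simp only [state, afterEmpty, afterPour] at ih ⊢
    push_cast
    split_ifs <;> linarith

variable {d c s} {p : ℕ} {ε : ℝ}

lemma abs_fill_sub_counter (hd : 0 < d) (hc : IsPouring n p ε c)
    (hs : ∀ j m, 0 < s j m ∧ s j m ≤ 1) (i : ℕ) (j : Fin n) :
    -1 ≤ (state d c s S i).fill j - (state d c s S i).counter j ∧
      (midState d c s S i).fill j - (midState d c s S i).counter j ≤ 3 := by
  have key := fun i => poured_sub_crossings hd (hs j) (a := fun t => poured c t j)
    (poured_zero c j)
    (monotone_nat_of_le_succ fun t => by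
      simp only [poured_succ]; linarith [hc.nonneg t j])
    (fun t => by simp only [poured_succ]; linarith [hc.le_one t j]) i
  constructor
  · rw [fill_sub_counter]; exact (key i).1
  · have h1 : (midState d c s S i).fill j - (midState d c s S i).counter j =
        (state d c s S (i + 1)).fill j - (state d c s S (i + 1)).counter j := by
      rw [state_succ]; simp only [afterEmpty]; ring
    rw [h1, fill_sub_counter]
    exact (key (i + 1)).2

end Run

/-! ### Greedy selection and outstanding jobs -/

section Greedy

variable {n p d : ℕ} {st : State n} {S : Finset (Fin n)}

open Classical in
/-- The cups of the highest priority level. -/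
def heavy (d : ℕ) (st : State n) : Finset (Fin n) :=
  Finset.univ.filter fun j => 1 + 1 / (d : ℝ) ≤ st.counter j

lemma mem_heavy {j : Fin n} : j ∈ heavy d st ↔ 1 + 1 / (d : ℝ) ≤ st.counter j := by
  simp [heavy]

lemma level_le_two (w : ℝ) : level d w ≤ 2 := by
  unfold level; split_ifs <;> norm_num

lemma level_eq_two_iff {w : ℝ} : level d w = 2 ↔ 1 + 1 / (d : ℝ) ≤ w := by
  unfold level; split_ifs <;> simp_all

/-- A selected cup that is not heavy would force all heavy cups, at least `p + 1`, into the
remaining `p` places. -/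
lemma IsGreedyChoice.subset_heavy (hS : IsGreedyChoice p d st S)
    (hb : p + 1 ≤ (heavy d st).card) : S.card = p + 1 ∧ S ⊆ heavy d st := by
  have hn : (heavy d st).card ≤ n := (Finset.card_le_univ _).trans_eq (Fintype.card_fin n)
  have hcard : S.card = p + 1 := by rw [hS.1]; omega
  refine ⟨hcard, fun j hj => ?_⟩
  by_contra hjh
  have hsub : heavy d st ⊆ S.erase j := by
    intro j' hj'
    refine Finset.mem_erase.2 ⟨fun h => hjh (h ▸ hj'), ?_⟩
    by_contra hj'S
    have h1 := level_eq_two_iff.2 (mem_heavy.1 hj')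
    have h2 : level d (st.counter j) = 2 := by
      have := level_le_two (d := d) (st.counter j)
      rcases hS.2 j hj j' hj'S with h | h <;> omega
    exact hjh (mem_heavy.2 (level_eq_two_iff.1 h2))
  have := Finset.card_le_card hsub
  rw [Finset.card_erase_of_mem hj] at this
  omega

/-- A heavy cup left out would make every selected cup heavy; the selection and this cup then
contradict either the bound `p` or the total number of cups. -/
lemma IsGreedyChoice.heavy_subset (hS : IsGreedyChoice p d st S)
    (hb : (heavy d st).card ≤ p) : heavy d st ⊆ S := by
  intro j' hj'
  by_contra hj'S
  have hsub : insert j' S ⊆ heavy d st := by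
    intro j hj
    rcases Finset.mem_insert.1 hj with rfl | hj
    · exact hj'
    · have h1 := level_eq_two_iff.2 (mem_heavy.1 hj')
      have h2 : level d (st.counter j) = 2 := by
        have := level_le_two (d := d) (st.counter j)
        rcases hS.2 j hj j' hj'S with h | h <;> omega
      exact mem_heavy.2 (level_eq_two_iff.1 h2)
  have h1 := Finset.card_le_card hsub
  have h2 : (insert j' S).card ≤ n := (Finset.card_le_univ _).trans_eq (Fintype.card_fin n)
  rw [Finset.card_insert_of_notMem hj'S, hS.1] at h1 h2
  omega

/-- The number of whole jobs, of size `1 + 1/d` each, outstanding in the counters. -/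
def work (d : ℕ) (st : State n) : ℝ :=
  ∑ j, ((⌊st.counter j / (1 + 1 / (d : ℝ))⌋ : ℤ) : ℝ)

lemma work_nonneg (hw : ∀ j, 0 ≤ st.counter j) : 0 ≤ work d st := by
  refine Finset.sum_nonneg fun j _ => ?_
  exact_mod_cast Int.floor_nonneg.2 (div_nonneg (hw j) (by positivity))

lemma removed_of_heavy {j : Fin n} (hj : j ∈ S) (hh : j ∈ heavy d st) :
    1 + 1 / (d : ℝ) ≤ removed d S st j := by
  rw [removed, if_pos hj]
  refine le_min ?_ (mem_heavy.1 hh)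
  gcongr
  norm_num

open Classical in
lemma work_afterEmpty_le (hw : ∀ j, 0 ≤ st.counter j) :
    work d (afterEmpty d S st) ≤ work d st - (S ∩ heavy d st).card := by
  have hpos : (0 : ℝ) < 1 + 1 / (d : ℝ) := by positivity
  have hcard : ((S ∩ heavy d st).card : ℝ) = ∑ j, if j ∈ S ∩ heavy d st then (1 : ℝ) else 0 := by
    rw [Finset.sum_ite_mem, Finset.univ_inter, Finset.sum_const, nsmul_one]
  rw [hcard, work, work, ← Finset.sum_sub_distrib]
  refine Finset.sum_le_sum fun j _ => ?_
  simp only [afterEmpty]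
  split_ifs with h
  · rw [Finset.mem_inter] at h
    have h1 : (st.counter j - removed d S st j) / (1 + 1 / (d : ℝ)) ≤
        st.counter j / (1 + 1 / (d : ℝ)) - 1 := by
      rw [div_le_iff₀ hpos, sub_mul, div_mul_cancel₀ _ hpos.ne']
      linarith [removed_of_heavy h.1 h.2]
    have h2 := Int.floor_le_floor h1
    rw [Int.floor_sub_one] at h2
    exact_mod_cast h2
  · rw [sub_zero]
    have h1 : (st.counter j - removed d S st j) / (1 + 1 / (d : ℝ)) ≤
        st.counter j / (1 + 1 / (d : ℝ)) := by
      gcongr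
      linarith [removed_nonneg d (T := S) (hw j)]
    exact_mod_cast Int.floor_le_floor h1

end Greedy

open Classical in
/-- The number of cups that cross a threshold in the `(i+1)`-st step. -/
def arrivals {n : ℕ} (d : ℕ) (c : ℕ → Fin n → ℝ) (s : Fin n → ℕ → ℝ) (i : ℕ) : ℝ :=
  ∑ j, if Crosses d (s j) (poured c i j) (poured c (i + 1) j) then 1 else 0

section Run

variable {n p d : ℕ} {ε : ℝ} {c : ℕ → Fin n → ℝ} {s : Fin n → ℕ → ℝ} {S : ℕ → Finset (Fin n)}

lemma work_midState (i : ℕ) :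
    work d (midState d c s S i) = work d (state d c s S i) + arrivals d c s i := by
  have hpos : (0 : ℝ) < 1 + 1 / (d : ℝ) := by positivity
  rw [work, work, arrivals, ← Finset.sum_add_distrib]
  refine Finset.sum_congr rfl fun j _ => ?_
  simp only [midState, afterPour]
  split_ifs
  · rw [add_div, div_self hpos.ne', Int.floor_add_one]
    push_cast
    ring
  · simp

open Classical in
lemma arrivals_le_heavy (i : ℕ) :
    arrivals d c s i ≤ (heavy d (midState d c s S i)).card := by
  have hcard : ((heavy d (midState d c s S i)).card : ℝ) =
      ∑ j, if j ∈ heavy d (midState d c s S i) then (1 : ℝ) else 0 := by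
    rw [Finset.sum_ite_mem, Finset.univ_inter, Finset.sum_const, nsmul_one]
  rw [hcard, arrivals]
  refine Finset.sum_le_sum fun j _ => ?_
  by_cases h : Crosses d (s j) (poured c i j) (poured c (i + 1) j)
  · have : j ∈ heavy d (midState d c s S i) := by
      rw [mem_heavy]
      simp only [midState, afterPour, if_pos h]
      linarith [(counter_nonneg d c s S i j).1]
    rw [if_pos h, if_pos this]
  · rw [if_neg h]
    split_ifs <;> norm_num

/-- By how much the number of crossings in a step exceeds `(1 - ε/2) p`. -/
def excess (p : ℕ) (ε : ℝ) (x : ℝ) : ℝ := max (x - (1 - ε / 2) * p) 0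

/-- A cup that has just crossed a threshold is heavy. All heavy cups are served, so at least as many
jobs are completed as arrive. -/
lemma work_succ_of_idle {i : ℕ}
    (hS : IsGreedyChoice p d (midState d c s S i) (S i))
    (hb : (heavy d (midState d c s S i)).card ≤ p) :
    work d (state d c s S (i + 1)) ≤ work d (state d c s S i) := by
  have h := work_afterEmpty_le (d := d) (S := S i) fun j => (counter_nonneg d c s S i j).2
  rw [Finset.inter_eq_right.2 (hS.heavy_subset hb), work_midState] at h
  rw [state_succ]
  linarith [arrivals_le_heavy (d := d) (c := c) (s := s) (S := S) i]

lemma work_succ_of_busy {i : ℕ}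
    (hS : IsGreedyChoice p d (midState d c s S i) (S i))
    (hb : p + 1 ≤ (heavy d (midState d c s S i)).card) :
    work d (state d c s S (i + 1)) ≤
      work d (state d c s S i) + (excess p ε (arrivals d c s i) - ε / 2 * p) := by
  have h := work_afterEmpty_le (d := d) (S := S i) fun j => (counter_nonneg d c s S i j).2
  obtain ⟨h1, h2⟩ := hS.subset_heavy hb
  rw [Finset.inter_eq_left.2 h2, work_midState, h1] at h
  rw [state_succ]
  have : arrivals d c s i - (1 - ε / 2) * p ≤ excess p ε (arrivals d c s i) := le_max_left _ _
  push_cast at h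
  linarith

/-- Only the at most `p` cups that were heavy can still hold a whole job, which turns a bound on
single counters into one on the total work, independent of `n`. -/
lemma work_succ_le_of_idle {i : ℕ} {H : ℝ} (hH : 0 ≤ H)
    (hb : (heavy d (midState d c s S i)).card ≤ p)
    (hw : ∀ j, (state d c s S (i + 1)).counter j ≤ H) :
    work d (state d c s S (i + 1)) ≤ p * H := by
  have hpos : (1 : ℝ) ≤ 1 + 1 / (d : ℝ) := le_add_of_nonneg_right (by positivity)
  have h0 := fun j => (counter_nonneg d c s S (i + 1) j).1
  calc work d (state d c s S (i + 1))
      ≤ ∑ j ∈ heavy d (midState d c s S i), H := by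
        rw [work, ← Finset.sum_subset (Finset.subset_univ (heavy d (midState d c s S i)))]
        · refine Finset.sum_le_sum fun j _ => (Int.floor_le _).trans ?_
          exact (div_le_self (h0 j) hpos).trans (hw j)
        · intro j _ hj
          rw [mem_heavy, not_le] at hj
          have h1 : (state d c s S (i + 1)).counter j ≤ (midState d c s S i).counter j := by
            rw [state_succ]
            exact sub_le_self _ (removed_nonneg d (counter_nonneg d c s S i j).2)
          have : ⌊(state d c s S (i + 1)).counter j / (1 + 1 / (d : ℝ))⌋ = 0 := by
            rw [Int.floor_eq_zero_iff]
            refine ⟨div_nonneg (h0 j) (by linarith), ?_⟩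
            rw [div_lt_one (by linarith)]
            linarith
          rw [this, Int.cast_zero]
    _ ≤ p * H := by
        rw [Finset.sum_const, nsmul_eq_mul]
        gcongr

end Run

/-! ### The exponential potential and its one-step changes -/

/-- The weight of a cup with fill `f` in the exponential potential; cups with fill at most `5` do
not count. -/
def bump (ε f : ℝ) : ℝ := max (Real.exp (ε * f) - Real.exp (ε * 5)) 0

section Bump

variable {ε : ℝ}

lemma bump_nonneg (f : ℝ) : 0 ≤ bump ε f := le_max_right _ _

lemma bump_mono (hε : 0 ≤ ε) : Monotone (bump ε) := fun f g h => by
  unfold bump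
  gcongr

lemma bump_of_le (hε : 0 ≤ ε) {f : ℝ} (hf : f ≤ 5) : bump ε f = 0 :=
  max_eq_right (sub_nonpos.2 (Real.exp_le_exp.2 (by gcongr)))

lemma bump_of_ge (hε : 0 ≤ ε) {f : ℝ} (hf : 5 ≤ f) :
    bump ε f = Real.exp (ε * f) - Real.exp (ε * 5) :=
  max_eq_left (sub_nonneg.2 (Real.exp_le_exp.2 (by gcongr)))

/-- Subtracting the constant `exp (ε * 5)` keeps the multiplicative contraction of the exponential,
because the contraction factor is at most 1. -/
lemma bump_sub_le (hε : 0 ≤ ε) (f : ℝ) {x : ℝ} (hx : 0 ≤ x) :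
    bump ε (f - x) ≤ Real.exp (-(ε * x)) * bump ε f := by
  refine max_le ?_ (mul_nonneg (Real.exp_pos _).le (bump_nonneg f))
  have h1 : Real.exp (ε * (f - x)) = Real.exp (-(ε * x)) * Real.exp (ε * f) := by
    rw [← Real.exp_add]; congr 1; ring
  have h2 : Real.exp (-(ε * x)) ≤ 1 := Real.exp_le_one_iff.2 (by nlinarith)
  calc Real.exp (ε * (f - x)) - Real.exp (ε * 5)
      ≤ Real.exp (-(ε * x)) * (Real.exp (ε * f) - Real.exp (ε * 5)) := by
        rw [h1]
        nlinarith [Real.exp_pos (ε * 5)]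
    _ ≤ _ := by
        gcongr
        exact le_max_left _ _

lemma exp_sub_exp_le (a x : ℝ) : Real.exp a - Real.exp (a - x) ≤ x * Real.exp a := by
  have h1 : Real.exp (a - x) = Real.exp a * Real.exp (-x) := by rw [← Real.exp_add]; rfl
  rw [h1]
  nlinarith [Real.add_one_le_exp (-x), Real.exp_pos a]

lemma bump_add_le (hε : 0 ≤ ε) {f x W : ℝ} (hx : 0 ≤ x) (hW : f + x ≤ W) :
    bump ε (f + x) ≤ bump ε f + ε * x * Real.exp (ε * W) := by
  have hexp : Real.exp (ε * (f + x)) ≤ Real.exp (ε * W) := Real.exp_le_exp.2 (by gcongr)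
  have hεx : 0 ≤ ε * x := mul_nonneg hε hx
  refine max_le ?_ (add_nonneg (bump_nonneg f) (by positivity))
  have h1 := exp_sub_exp_le (ε * (f + x)) (ε * x)
  rw [show ε * (f + x) - ε * x = ε * f by ring] at h1
  have h2 : Real.exp (ε * f) - Real.exp (ε * 5) ≤ bump ε f := le_max_left _ _
  nlinarith

lemma bump_sub_one_le (hε : 0 ≤ ε) {f x W : ℝ} (hx : x ≤ 1) (hf : 6 ≤ f + x) (hW : W ≤ f + x) :
    bump ε (f + x - 1) ≤ bump ε f - ε * (1 - x) * Real.exp (ε * (W - 1)) := by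
  rw [bump_of_ge hε (by linarith), bump_of_ge hε (by linarith)]
  have h1 : Real.exp (ε * f) = Real.exp (ε * (f + x - 1)) * Real.exp (ε * (1 - x)) := by
    rw [← Real.exp_add]; congr 1; ring
  have h2 : Real.exp (ε * (W - 1)) ≤ Real.exp (ε * (f + x - 1)) :=
    Real.exp_le_exp.2 (by gcongr)
  have h3 : 0 ≤ ε * (1 - x) := mul_nonneg hε (by linarith)
  rw [h1]
  nlinarith [Real.add_one_le_exp (ε * (1 - x)), Real.exp_pos (ε * (f + x - 1)),
    mul_le_mul_of_nonneg_left h2 h3]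

end Bump

/-- The exponential potential of the cups. -/
def potential {n : ℕ} (ε : ℝ) (st : State n) : ℝ := ∑ j, bump ε (st.fill j)

/-- The largest possible increase of the potential in a step. -/
def maxIncrease (p : ℕ) (ε : ℝ) : ℝ := ε * p * Real.exp (ε * 6)

section Step

variable {n p d : ℕ} {ε : ℝ} {st mid : State n} {S : Finset (Fin n)} {c : Fin n → ℝ}

lemma removed_eq {j : Fin n} (hj : j ∈ S) (h : 1 + 2 / (d : ℝ) ≤ mid.counter j) :
    removed d S mid j = 1 + 2 / (d : ℝ) := by
  rw [removed, if_pos hj, min_eq_left h]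

lemma bump_removed_le (hε : 0 ≤ ε) {j : Fin n} (hj : j ∈ S) (hc : c j ≤ 1)
    (hfill : mid.fill j = st.fill j + c j) (h : 1 + 2 / (d : ℝ) ≤ mid.counter j) :
    bump ε ((afterEmpty d S mid).fill j) ≤
      Real.exp (-(ε * (2 / (d : ℝ)))) * bump ε (st.fill j) := by
  refine le_trans (bump_mono hε ?_) (bump_sub_le hε _ (by positivity))
  simp only [afterEmpty, removed_eq hj h, hfill]
  linarith

lemma afterEmpty_fill_le (hw : ∀ j, 0 ≤ mid.counter j) (j : Fin n) :
    (afterEmpty d S mid).fill j ≤ mid.fill j :=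
  sub_le_self _ (removed_nonneg d (hw j))

lemma potential_afterEmpty_of_subset (hε : 0 ≤ ε) (hc1 : ∀ j, c j ≤ 1)
    (hfill : ∀ j, mid.fill j = st.fill j + c j) (hw : ∀ j, 0 ≤ mid.counter j)
    (hfull : ∀ j, 5 ≤ mid.fill j → 1 + 2 / (d : ℝ) ≤ mid.counter j)
    (hS : ∀ j, 5 ≤ mid.fill j → j ∈ S) :
    potential ε (afterEmpty d S mid) ≤
      Real.exp (-(ε * (2 / (d : ℝ)))) * potential ε st := by
  rw [potential, potential, Finset.mul_sum]
  refine Finset.sum_le_sum fun j _ => ?_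
  rcases le_total 5 (mid.fill j) with h | h
  · exact bump_removed_le hε (hS j h) (hc1 j) (hfill j) (hfull j h)
  · rw [bump_of_le hε ((afterEmpty_fill_le hw j).trans h)]
    exact mul_nonneg (Real.exp_pos _).le (bump_nonneg _)

/-- `W` separates selected cups from the others that count. Gains outside `S` have slope at most `ε
e^{εW}`; losses inside have slope at least `ε e^{ε(W-1)}`, and the greater number of units removed
makes up for the factor `e^{-ε}`. -/
lemma potential_afterEmpty_le (hε : 0 ≤ ε) (hε1 : ε ≤ 1) (hc0 : ∀ j, 0 ≤ c j)
    (hc1 : ∀ j, c j ≤ 1) (hsum : ∑ j, c j ≤ (1 - ε) * p)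
    (hfill : ∀ j, mid.fill j = st.fill j + c j) (hw : ∀ j, 0 ≤ mid.counter j)
    (hfull : ∀ j, 5 ≤ mid.fill j → 1 + 2 / (d : ℝ) ≤ mid.counter j)
    (hcard : S.card = p + 1) {W : ℝ} (hSW : ∀ j ∈ S, W ≤ mid.fill j) (hW : 5 ≤ W)
    (hSc : ∀ j ∉ S, 5 ≤ mid.fill j → mid.fill j ≤ W) :
    potential ε (afterEmpty d S mid) ≤ potential ε st + maxIncrease p ε := by
  classical
  have hd0 : (0 : ℝ) ≤ 2 / (d : ℝ) := by positivity
  have hout : ∀ j ∉ S, bump ε ((afterEmpty d S mid).fill j) ≤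
      bump ε (st.fill j) + ε * c j * Real.exp (ε * W) := by
    intro j hj
    refine (bump_mono hε (afterEmpty_fill_le hw j)).trans ?_
    rw [hfill]
    refine bump_add_le hε (hc0 j) ?_
    rw [← hfill]
    rcases le_total 5 (mid.fill j) with h | h
    · exact hSc j hj h
    · exact h.trans hW
  have hsplit : ∀ f : Fin n → ℝ, ∑ j, f j = ∑ j ∈ S, f j + ∑ j ∈ Sᶜ, f j :=
    fun f => (Finset.sum_add_sum_compl S f).symm
  have hEW := Real.exp_pos (ε * W)
  have hsumout : ∑ j ∈ Sᶜ, bump ε ((afterEmpty d S mid).fill j) ≤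
      ∑ j ∈ Sᶜ, bump ε (st.fill j) + ε * Real.exp (ε * W) * ∑ j ∈ Sᶜ, c j := by
    rw [Finset.mul_sum, ← Finset.sum_add_distrib]
    refine Finset.sum_le_sum fun j hj => (hout j (Finset.mem_compl.1 hj)).trans_eq (by ring)
  rw [hsplit] at hsum
  have hA : 0 ≤ ∑ j ∈ S, c j := Finset.sum_nonneg fun j _ => hc0 j
  have hp : (0 : ℝ) ≤ p := p.cast_nonneg
  have hεp : 0 ≤ ε * p := mul_nonneg hε hp
  rw [potential, potential, hsplit, hsplit fun j => bump ε (st.fill j)]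
  -- For `W ≥ 6` a selected cup stays above the cutoff 5 after losing one unit, so the purely
  -- exponential formula applies. For `W ≤ 6` the gain outside `S` is bounded outright.
  rcases le_total 6 W with h6 | h6
  · have hin : ∑ j ∈ S, bump ε ((afterEmpty d S mid).fill j) ≤
        ∑ j ∈ S, bump ε (st.fill j) -
          ε * Real.exp (ε * (W - 1)) * ((p + 1) - ∑ j ∈ S, c j) := by
      have : ((p : ℝ) + 1) = ∑ j ∈ S, (1 : ℝ) := by simp [hcard]
      rw [this, ← Finset.sum_sub_distrib, Finset.mul_sum, ← Finset.sum_sub_distrib]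
      refine Finset.sum_le_sum fun j hj => ?_
      have hWj := hSW j hj
      have hremoved := removed_eq hj (hfull j (hW.trans hWj))
      rw [hfill] at hWj
      refine (bump_mono hε (?_ : _ ≤ st.fill j + c j - 1)).trans
        ((bump_sub_one_le hε (hc1 j) (h6.trans hWj) hWj).trans_eq (by ring))
      simp only [afterEmpty, hremoved, hfill]
      linarith
    have hexp : Real.exp (ε * (W - 1)) = Real.exp (ε * W) * Real.exp (-ε) := by
      rw [← Real.exp_add]; congr 1; ring
    have hE1 : 1 - ε ≤ Real.exp (-ε) := by linarith [Real.add_one_le_exp (-ε)]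
    have hE2 : Real.exp (-ε) ≤ 1 := Real.exp_le_one_iff.2 (by linarith)
    -- From `1 - ε ≤ e^{-ε} ≤ 1`: the left side is at most `(1 - ε) p` minus the amount poured into
    -- `S`.
    have hbracket : ∑ j ∈ Sᶜ, c j ≤ Real.exp (-ε) * ((p + 1) - ∑ j ∈ S, c j) := by
      nlinarith [Real.exp_pos (-ε)]
    have hK : 0 ≤ maxIncrease p ε := mul_nonneg hεp (Real.exp_pos _).le
    rw [hexp] at hin
    have := mul_le_mul_of_nonneg_left hbracket (mul_nonneg hε hEW.le)
    nlinarith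
  · have hin : ∑ j ∈ S, bump ε ((afterEmpty d S mid).fill j) ≤ ∑ j ∈ S, bump ε (st.fill j) := by
      refine Finset.sum_le_sum fun j hj => ?_
      refine (bump_removed_le hε hj (hc1 j) (hfill j)
        (hfull j (hW.trans (hSW j hj)))).trans ?_
      refine mul_le_of_le_one_left (bump_nonneg _) (Real.exp_le_one_iff.2 ?_)
      have := mul_nonneg hε hd0
      linarith
    have hE6 : Real.exp (ε * W) ≤ Real.exp (ε * 6) := Real.exp_le_exp.2 (by gcongr)
    have hcout : ∑ j ∈ Sᶜ, c j ≤ p := by nlinarith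
    have hcout0 : 0 ≤ ∑ j ∈ Sᶜ, c j := Finset.sum_nonneg fun j _ => hc0 j
    have : ε * Real.exp (ε * W) * ∑ j ∈ Sᶜ, c j ≤ maxIncrease p ε := by
      rw [maxIncrease]
      calc ε * Real.exp (ε * W) * ∑ j ∈ Sᶜ, c j ≤ ε * Real.exp (ε * 6) * p := by gcongr
        _ = _ := by ring
    linarith

end Step

section Run

variable {n p d : ℕ} {ε : ℝ} {c : ℕ → Fin n → ℝ} {s : Fin n → ℕ → ℝ} {S : ℕ → Finset (Fin n)}

/-- This is why the cutoff is 5: the counter is then at least `5 - 3 = 2`, so a selected cup loses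
the full `1 + 2/d`. -/
lemma counter_of_five_le (hd : 2 ≤ d) (hc : IsPouring n p ε c)
    (hs : ∀ j m, 0 < s j m ∧ s j m ≤ 1) {i : ℕ} {j : Fin n}
    (h : 5 ≤ (midState d c s S i).fill j) :
    1 + 2 / (d : ℝ) ≤ (midState d c s S i).counter j := by
  have h1 := (abs_fill_sub_counter S (by omega : 0 < d) hc hs i j).2
  have h2 : 2 / (d : ℝ) ≤ 1 := by
    rw [div_le_one (by positivity)]
    exact_mod_cast hd
  linarith

lemma mem_heavy_of_five_le (hd : 2 ≤ d) (hc : IsPouring n p ε c)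
    (hs : ∀ j m, 0 < s j m ∧ s j m ≤ 1) {i : ℕ} {j : Fin n}
    (h : 5 ≤ (midState d c s S i).fill j) : j ∈ heavy d (midState d c s S i) := by
  refine mem_heavy.2 (le_trans ?_ (counter_of_five_le hd hc hs h))
  gcongr
  norm_num

lemma potential_succ_of_idle (hε : 0 ≤ ε) (hd : 2 ≤ d) (hc : IsPouring n p ε c)
    (hs : ∀ j m, 0 < s j m ∧ s j m ≤ 1) {i : ℕ}
    (hS : IsGreedyChoice p d (midState d c s S i) (S i))
    (hb : (heavy d (midState d c s S i)).card ≤ p) :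
    potential ε (state d c s S (i + 1)) ≤
      Real.exp (-(ε * (2 / (d : ℝ)))) * potential ε (state d c s S i) :=
  potential_afterEmpty_of_subset hε (hc.le_one i) (midState_fill d c s S i)
    (fun j => (counter_nonneg d c s S i j).2) (fun _ => counter_of_five_le hd hc hs)
    fun _ h => hS.heavy_subset hb (mem_heavy_of_five_le hd hc hs h)

lemma potential_nonneg (st : State n) : 0 ≤ potential ε st :=
  Finset.sum_nonneg fun _ _ => bump_nonneg _

lemma potential_succ_le (hε : 0 ≤ ε) (hε1 : ε ≤ 1) (hd : 2 ≤ d) (hc : IsPouring n p ε c)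
    (hs : ∀ j m, 0 < s j m ∧ s j m ≤ 1) {i : ℕ}
    (hS : IsGreedyChoice p d (midState d c s S i) (S i))
    (hb : p + 1 ≤ (heavy d (midState d c s S i)).card) :
    potential ε (state d c s S (i + 1)) ≤
      potential ε (state d c s S i) + maxIncrease p ε := by
  obtain ⟨hcard, hsub⟩ := hS.subset_heavy hb
  have hw := fun j => (counter_nonneg d c s S i j).2
  by_cases hall : ∀ j, 5 ≤ (midState d c s S i).fill j → j ∈ S i
  · refine (potential_afterEmpty_of_subset hε (hc.le_one i) (midState_fill d c s S i) hw
      (fun _ => counter_of_five_le hd hc hs) hall).trans ?_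
    have h1 : Real.exp (-(ε * (2 / (d : ℝ)))) ≤ 1 :=
      Real.exp_le_one_iff.2 (neg_nonpos.2 (by positivity))
    have h2 : 0 ≤ maxIncrease p ε := by unfold maxIncrease; positivity
    exact (mul_le_of_le_one_left (potential_nonneg _) h1).trans (le_add_of_nonneg_right h2)
  · push Not at hall
    obtain ⟨j₀, hj₀, hj₀S⟩ := hall
    have hle : ∀ j' ∉ S i, 5 ≤ (midState d c s S i).fill j' → ∀ j ∈ S i,
        (midState d c s S i).fill j' ≤ (midState d c s S i).fill j := by
      intro j' hj' h5 j hj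
      have h2 := level_eq_two_iff.2 (mem_heavy.1 (mem_heavy_of_five_le hd hc hs h5))
      have h3 := level_le_two (d := d) ((midState d c s S i).counter j)
      rcases hS.2 j hj j' hj' with h | h
      · omega
      · exact h.2
    have hne : (S i).Nonempty := Finset.card_pos.1 (by omega)
    obtain ⟨j₁, hj₁, hmin⟩ := (S i).exists_min_image (midState d c s S i).fill hne
    exact potential_afterEmpty_le hε hε1 (hc.nonneg i) (hc.le_one i) (hc.sum_le i)
      (midState_fill d c s S i) hw (fun _ => counter_of_five_le hd hc hs) hcard hmin
      (hj₀.trans (hle j₀ hj₀S hj₀ j₁ hj₁)) fun j hj h5 => hle j hj h5 j₁ hj₁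

lemma fill_le_potential (hε : 0 < ε) (st : State n) (j : Fin n) :
    st.fill j ≤ 5 + potential ε st / ε := by
  have h1 : bump ε (st.fill j) ≤ potential ε st :=
    Finset.single_le_sum (f := fun j => bump ε (st.fill j)) (fun _ _ => bump_nonneg _)
      (Finset.mem_univ j)
  have h2 : ε * (st.fill j - 5) ≤ potential ε st := by
    rcases le_total (st.fill j) 5 with h | h
    · exact (mul_nonpos_of_nonneg_of_nonpos hε.le (by linarith)).trans (potential_nonneg st)
    · refine le_trans ?_ h1
      rw [bump_of_ge hε.le h]
      have h3 : Real.exp (ε * st.fill j) =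
          Real.exp (ε * (st.fill j - 5)) * Real.exp (ε * 5) := by
        rw [← Real.exp_add]; congr 1; ring
      have h4 : 1 ≤ Real.exp (ε * 5) := Real.one_le_exp (by positivity)
      have h5 : 0 ≤ ε * (st.fill j - 5) := mul_nonneg hε.le (by linarith)
      rw [h3]
      nlinarith [Real.add_one_le_exp (ε * (st.fill j - 5))]
  have : st.fill j - 5 ≤ potential ε st / ε := by
    rw [le_div_iff₀ hε]
    linarith
  linarith

end Run

/-! ### From a large potential to a window of excess crossings -/

/-- Above this level the potential drops by at least four times `maxIncrease p ε` in every step in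
which all heavy cups are selected. -/
def plateau (p d : ℕ) (ε : ℝ) : ℝ := 4 * maxIncrease p ε * d / ε

section Run

variable {n p d : ℕ} {ε : ℝ} {c : ℕ → Fin n → ℝ} {s : Fin n → ℕ → ℝ} {S : ℕ → Finset (Fin n)}

lemma potential_succ_of_idle_of_plateau_lt (hε : 0 < ε) (hε1 : ε ≤ 1 / 2) (hd : 2 ≤ d)
    (hc : IsPouring n p ε c) (hs : ∀ j m, 0 < s j m ∧ s j m ≤ 1) {i : ℕ}
    (hS : IsGreedyChoice p d (midState d c s S i) (S i))
    (hb : (heavy d (midState d c s S i)).card ≤ p)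
    (hM : plateau p d ε < potential ε (state d c s S (i + 1))) :
    potential ε (state d c s S (i + 1)) ≤
      potential ε (state d c s S i) - 4 * maxIncrease p ε := by
  have h1 := potential_succ_of_idle hε.le hd hc hs hS hb
  have hd' : (2 : ℝ) ≤ d := by exact_mod_cast hd
  have hd0 : (0 : ℝ) < d := by linarith
  set x := ε * (2 / (d : ℝ)) with hx
  have hx0 : 0 < x := by positivity
  have hx1 : x ≤ 1 / 2 := by
    have : 2 / (d : ℝ) ≤ 1 := (div_le_one hd0).2 hd'
    nlinarith
  have h2 : Real.exp (-x) ≤ 1 - x / 2 := by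
    have := (abs_le.1 (Real.abs_exp_sub_one_sub_id_le (x := -x)
      (by rw [abs_neg, abs_of_pos hx0]; linarith))).2
    nlinarith
  have h3 := potential_nonneg (ε := ε) (state d c s S i)
  have h4 : potential ε (state d c s S (i + 1)) ≤
      potential ε (state d c s S i) - x / 2 * potential ε (state d c s S i) := by nlinarith
  have h5 : plateau p d ε ≤ potential ε (state d c s S i) := by nlinarith
  have h6 : x / 2 * plateau p d ε = 4 * maxIncrease p ε := by
    rw [hx, plateau]
    field_simp
  nlinarith [mul_le_mul_of_nonneg_left h5 (by positivity : 0 ≤ x / 2)]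

-- The window starts after the last idle step that left the potential at most `plateau`, or at time
-- 0. Idleness at that moment matters: together with the small potential it bounds the initial work.
open Classical in
lemma exists_drift_window (hε : 0 < ε) (hε1 : ε ≤ 1 / 2) (hd : 2 ≤ d)
    (hc : IsPouring n p ε c) (hs : ∀ j m, 0 < s j m ∧ s j m ≤ 1)
    (hS : IsSmoothedGreedy p d c s S) (i : ℕ) :
    ∃ t ≤ i,
      potential ε (state d c s S i) ≤ plateau p d ε + ∑ τ ∈ Finset.Ico t i,
        (if p + 1 ≤ (heavy d (midState d c s S τ)).card then maxIncrease p ε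
          else -4 * maxIncrease p ε) ∧
      work d (state d c s S i) ≤ p * (6 + plateau p d ε / ε) + ∑ τ ∈ Finset.Ico t i,
        (excess p ε (arrivals d c s τ) -
          if p + 1 ≤ (heavy d (midState d c s S τ)).card then ε / 2 * p else 0) := by
  have hM : 0 ≤ plateau p d ε := by unfold plateau maxIncrease; positivity
  have hH : 0 ≤ 6 + plateau p d ε / ε := by positivity
  induction i with
  | zero =>
    refine ⟨0, le_rfl, ?_, ?_⟩
    · have : potential ε (state d c s S 0) = 0 :=
        Finset.sum_eq_zero fun j _ => bump_of_le hε.le (by simp [state])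
      simpa [this] using hM
    · have : work d (state d c s S 0) = 0 :=
        Finset.sum_eq_zero fun j _ => by simp [state]
      rw [this, Finset.Ico_self, Finset.sum_empty, add_zero]
      positivity
  | succ i ih =>
    obtain ⟨t, hti, h1, h2⟩ := ih
    by_cases hb : p + 1 ≤ (heavy d (midState d c s S i)).card
    · refine ⟨t, hti.trans (Nat.le_succ i), ?_, ?_⟩
      · rw [Finset.sum_Ico_succ_top hti, if_pos hb]
        linarith [potential_succ_le hε.le (by linarith) hd hc hs (hS i) hb]
      · rw [Finset.sum_Ico_succ_top hti, if_pos hb]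
        linarith [work_succ_of_busy (ε := ε) (hS i) hb]
    · have hb' : (heavy d (midState d c s S i)).card ≤ p := by omega
      rcases le_or_gt (potential ε (state d c s S (i + 1))) (plateau p d ε) with hle | hgt
      · refine ⟨i + 1, le_rfl, by simpa using hle, ?_⟩
        rw [Finset.Ico_self, Finset.sum_empty, add_zero]
        refine work_succ_le_of_idle hH hb' fun j => ?_
        have h3 := (abs_fill_sub_counter S (by omega : 0 < d) hc hs (i + 1) j).1
        have h4 := fill_le_potential hε (state d c s S (i + 1)) j
        have h5 : potential ε (state d c s S (i + 1)) / ε ≤ plateau p d ε / ε := by gcongr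
        linarith
      · refine ⟨t, hti.trans (Nat.le_succ i), ?_, ?_⟩
        · rw [Finset.sum_Ico_succ_top hti, if_neg hb]
          linarith [potential_succ_of_idle_of_plateau_lt hε hε1 hd hc hs (hS i) hb' hgt]
        · rw [Finset.sum_Ico_succ_top hti, if_neg hb]
          have : 0 ≤ excess p ε (arrivals d c s i) := le_max_right _ _
          linarith [work_succ_of_idle (hS i) hb']

/-- A large potential forces a long window with many more crossings than expected. -/
lemma exists_excess_window (hp : 0 < p) (hε : 0 < ε) (hε1 : ε ≤ 1 / 2) (hd : 2 ≤ d)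
    (hc : IsPouring n p ε c) (hs : ∀ j m, 0 < s j m ∧ s j m ≤ 1)
    (hS : IsSmoothedGreedy p d c s S) {i : ℕ} {L : ℝ} (hL : 0 ≤ L)
    (hLH : 7 * (6 + plateau p d ε / ε) ≤ ε * L)
    (hpot : plateau p d ε + maxIncrease p ε * L < potential ε (state d c s S i)) :
    ∃ t ≤ i, L ≤ (i - t : ℕ) ∧
      ε * p * (i - t : ℕ) / 4 ≤ ∑ τ ∈ Finset.Ico t i, excess p ε (arrivals d c s τ) := by
  classical
  obtain ⟨t, hti, h1, h2⟩ := exists_drift_window hε hε1 hd hc hs hS i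
  have hp' : (0 : ℝ) < p := by exact_mod_cast hp
  have hK : 0 < maxIncrease p ε := by unfold maxIncrease; positivity
  set β : ℝ := ∑ τ ∈ Finset.Ico t i,
    if p + 1 ≤ (heavy d (midState d c s S τ)).card then (1 : ℝ) else 0 with hβ
  have hcard : ((i - t : ℕ) : ℝ) = ∑ τ ∈ Finset.Ico t i, (1 : ℝ) := by simp
  have hβL : β ≤ (i - t : ℕ) := by
    rw [hcard]
    exact Finset.sum_le_sum fun τ _ => by split_ifs <;> norm_num
  have e1 : ∑ τ ∈ Finset.Ico t i, (if p + 1 ≤ (heavy d (midState d c s S τ)).card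
      then maxIncrease p ε else -4 * maxIncrease p ε) =
      maxIncrease p ε * (5 * β - 4 * (i - t : ℕ)) := by
    rw [hβ, hcard, Finset.mul_sum, Finset.mul_sum, ← Finset.sum_sub_distrib, Finset.mul_sum]
    refine Finset.sum_congr rfl fun τ _ => ?_
    split_ifs <;> ring
  have e2 : ∑ τ ∈ Finset.Ico t i, (excess p ε (arrivals d c s τ) -
      if p + 1 ≤ (heavy d (midState d c s S τ)).card then ε / 2 * p else 0) =
      ∑ τ ∈ Finset.Ico t i, excess p ε (arrivals d c s τ) - ε / 2 * p * β := by
    rw [hβ, Finset.mul_sum, ← Finset.sum_sub_distrib]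
    refine Finset.sum_congr rfl fun τ _ => ?_
    split_ifs <;> ring
  rw [e1] at h1
  rw [e2] at h2
  -- With `β` busy steps the drift totals `K β - 4 K (ℓ - β)`. As `β ≤ ℓ`, this yields both `ℓ > L`
  -- and `β > 4 ℓ / 5`.
  have h3 : L < 5 * β - 4 * (i - t : ℕ) := by
    by_contra! h
    have := mul_le_mul_of_nonneg_left h hK.le
    linarith
  refine ⟨t, hti, by linarith, ?_⟩
  have h4 := work_nonneg (d := d) fun j => (counter_nonneg d c s S i j).1
  have hεp : 0 < ε * p := by positivity
  have h5 : ε * p * L ≤ ε * p * (5 * β - 4 * (i - t : ℕ)) := by gcongr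
  have h6 : p * (7 * (6 + plateau p d ε / ε)) ≤ p * (ε * L) := by gcongr
  have h7 : ε * p * L ≤ ε * p * (i - t : ℕ) := by
    gcongr
    linarith
  clear_value β
  generalize ((i - t : ℕ) : ℝ) = ℓ at *
  generalize 6 + plateau p d ε / ε = H at *
  generalize ∑ τ ∈ Finset.Ico t i, excess p ε (arrivals d c s τ) = E at *
  have h8 : 0 ≤ ε * p * L := by positivity
  have h9 : ε * p * (5 * β - 4 * ℓ) = 5 * (ε * p * β) - 4 * (ε * p * ℓ) := by ring
  have h10 : ε / 2 * p * β = ε * p * β / 2 := by ring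
  have h11 : p * (ε * L) = ε * p * L := by ring
  rw [h9] at h5
  rw [h10] at h2
  rw [h11] at h6
  linarith

end Run

/-! ### Exponential moments of functions of independent variables -/

section Tensor

variable {α : Type*} [MeasurableSpace α] {ν : Measure α} [IsProbabilityMeasure ν]

lemma integrable_of_abs_le {β : Type*} [MeasurableSpace β] {ρ : Measure β} [IsFiniteMeasure ρ]
    {f : β → ℝ} (hf : Measurable f) {C : ℝ} (hC : ∀ x, |f x| ≤ C) : Integrable f ρ :=
  Integrable.of_bound hf.aestronglyMeasurable C (Filter.Eventually.of_forall hC)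

lemma integrable_exp_of_abs_le {β : Type*} [MeasurableSpace β] {ρ : Measure β}
    [IsFiniteMeasure ρ] {f : β → ℝ} (hf : Measurable f) {C : ℝ} (hC : ∀ x, |f x| ≤ C) {η : ℝ}
    (hη : 0 ≤ η) : Integrable (fun x => Real.exp (η * f x)) ρ := by
  refine integrable_of_abs_le (by fun_prop) (C := Real.exp (η * C)) fun x => ?_
  rw [Real.abs_exp]
  exact Real.exp_le_exp.2 (mul_le_mul_of_nonneg_left (le_of_abs_le (hC x)) hη)

/-- A bound for the exponential moment of a function whose values off `A` are minimal, and whose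
values on `A` exceed the minimum by at most `b`. -/
lemma integral_exp_le {f : α → ℝ} (hf : Measurable f) {C : ℝ} (hC : ∀ x, |f x| ≤ C) {A : Set α}
    (hA : MeasurableSet A) {b η : ℝ} (hη : 0 ≤ η) (hηb : η * b ≤ 1)
    (h : ∀ v v', f v ≤ f v' + A.indicator (fun _ => b) v) :
    ∫ x, Real.exp (η * f x) ∂ν ≤
      Real.exp (η * ∫ x, f x ∂ν + η ^ 2 * b ^ 2 * ν.real A) := by
  have hne : Nonempty α := nonempty_of_isProbabilityMeasure ν
  have hbdd : BddBelow (Set.range f) := ⟨-C, by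
    rintro _ ⟨x, rfl⟩
    exact (abs_le.1 (hC x)).1⟩
  set G := ⨅ v, f v
  have hG : ∀ v, G ≤ f v := fun v => ciInf_le hbdd v
  have hG' : ∀ v, f v - A.indicator (fun _ => b) v ≤ G := fun v =>
    le_ciInf fun v' => by linarith [h v v']
  -- Off `A` the function equals its infimum `G`; on `A`, `e^x ≤ 1 + x + x²` for `0 ≤ x ≤ 1`. The
  -- quadratic term is therefore paid only on `A`.
  have hpt : ∀ v, Real.exp (η * f v) ≤
      Real.exp (η * G) * (1 + η * (f v - G) + A.indicator (fun _ => η ^ 2 * b ^ 2) v) := by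
    intro v
    have h1 : Real.exp (η * f v) = Real.exp (η * G) * Real.exp (η * (f v - G)) := by
      rw [← Real.exp_add]; congr 1; ring
    rw [h1]
    refine mul_le_mul_of_nonneg_left ?_ (Real.exp_pos _).le
    have h2 := hG v
    have h3 := hG' v
    by_cases hv : v ∈ A
    · rw [Set.indicator_of_mem hv] at h3 ⊢
      have h4 : 0 ≤ η * (f v - G) := mul_nonneg hη (by linarith)
      have h5 : η * (f v - G) ≤ η * b := mul_le_mul_of_nonneg_left (by linarith) hη
      have h6 := (abs_le.1 (Real.abs_exp_sub_one_sub_id_le (x := η * (f v - G))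
        (by rw [abs_of_nonneg h4]; linarith))).2
      nlinarith
    · rw [Set.indicator_of_notMem hv] at h3 ⊢
      have : f v - G = 0 := by linarith
      simp [this]
  have hint : Integrable f ν := integrable_of_abs_le hf hC
  have hindi : Integrable (A.indicator fun _ => η ^ 2 * b ^ 2) ν :=
    (integrable_const _).indicator hA
  have hsub : Integrable (fun v => η * (f v - G)) ν := (hint.sub (integrable_const _)).const_mul η
  have hone : Integrable (fun v => 1 + η * (f v - G)) ν := (integrable_const _).add hsub
  calc ∫ x, Real.exp (η * f x) ∂ν
      ≤ ∫ v, Real.exp (η * G) *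
          (1 + η * (f v - G) + A.indicator (fun _ => η ^ 2 * b ^ 2) v) ∂ν :=
        integral_mono (integrable_exp_of_abs_le hf hC hη) ((hone.add hindi).const_mul _) hpt
    _ = Real.exp (η * G) * (1 + η * (∫ v, f v ∂ν - G) + η ^ 2 * b ^ 2 * ν.real A) := by
        rw [integral_const_mul, integral_add hone hindi, integral_add (integrable_const _) hsub,
          integral_const_mul, integral_sub hint (integrable_const _), integral_indicator_const _ hA]
        simp [mul_comm]
    _ ≤ Real.exp (η * G) *
          Real.exp (η * (∫ v, f v ∂ν - G) + η ^ 2 * b ^ 2 * ν.real A) := by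
        gcongr
        linarith [Real.add_one_le_exp (η * (∫ v, f v ∂ν - G) + η ^ 2 * b ^ 2 * ν.real A)]
    _ = _ := by
        rw [← Real.exp_add]; congr 1; ring

/-- A Bernstein-type bound for the exponential moment of a function of independent variables, in
which the `i`-th variable matters only if it lies in `A i`, and then by at most `b`. -/
lemma integral_exp_pi_le {b η : ℝ} (hη : 0 ≤ η) (hηb : η * b ≤ 1) :
    ∀ (N : ℕ) (F : (Fin N → α) → ℝ) (A : Fin N → Set α), Measurable F →
      (∃ C, ∀ x, |F x| ≤ C) → (∀ q, MeasurableSet (A q)) →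
      (∀ q x v, F x ≤ F (Function.update x q v) + (A q).indicator (fun _ => b) (x q)) →
      ∫ x, Real.exp (η * F x) ∂(Measure.pi fun _ : Fin N => ν) ≤
        Real.exp (η * ∫ x, F x ∂(Measure.pi fun _ : Fin N => ν) +
          η ^ 2 * b ^ 2 * ∑ q, ν.real (A q)) := by
  intro N
  induction N with
  | zero =>
    intro F A _ _ _ _
    have : ∀ g : (Fin 0 → α) → ℝ,
        ∫ x, g x ∂(Measure.pi fun _ : Fin 0 => ν) = g (fun i => i.elim0) := by
      intro g
      have h1 : g = fun _ => g (fun i => i.elim0) := funext fun x => congrArg g (Subsingleton.elim _ _)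
      rw [h1]
      simp
    rw [this, this]
    simp
  | succ N ih =>
    rintro F A hF ⟨C, hC⟩ hA h
    set π := Measure.pi fun _ : Fin N => ν with hπ
    have htr : ∀ g : (Fin (N + 1) → α) → ℝ,
        ∫ x, g x ∂(Measure.pi fun _ : Fin (N + 1) => ν) =
          ∫ z, g (Fin.cons z.2 z.1) ∂(π.prod ν) := by
      intro g
      have hmp := (measurePreserving_piFinSuccAbove (fun _ : Fin (N + 1) => ν) 0)
      have h1 := hmp.symm.integral_comp' g
      rw [← h1, ← integral_prod_swap]
      refine integral_congr_ae (Filter.Eventually.of_forall fun z => ?_)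
      refine congrArg g (funext fun q => ?_)
      refine Fin.cases ?_ (fun q => ?_) q <;> simp
    have hcons : Measurable fun z : (Fin N → α) × α => (Fin.cons z.2 z.1 : Fin (N + 1) → α) := by
      refine measurable_pi_iff.2 fun q => ?_
      refine Fin.cases ?_ (fun q => ?_) q
      · simpa using measurable_snd
      · simpa [Function.comp_def] using
          (measurable_pi_apply (X := fun _ : Fin N => α) q).comp measurable_fst
    have hFc : Measurable fun z : (Fin N → α) × α => F (Fin.cons z.2 z.1) := hF.comp hcons
    have hFy : ∀ y : Fin N → α, Measurable fun v => F (Fin.cons v y) := fun y =>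
      hFc.comp measurable_prodMk_left
    have hint : ∀ y : Fin N → α, Integrable (fun v => F (Fin.cons v y)) ν := fun y =>
      integrable_of_abs_le (hFy y) fun v => hC _
    -- Averaging out the first coordinate preserves the mean and the bounded influence of each
    -- remaining coordinate, so the induction hypothesis applies to `G`.
    set G : (Fin N → α) → ℝ := fun y => ∫ v, F (Fin.cons v y) ∂ν with hG
    have hGm : Measurable G :=
      (hFc.stronglyMeasurable.integral_prod_right' (ν := ν)).measurable
    have hGC : ∀ y, |G y| ≤ C := fun y => by
      have := norm_integral_le_of_norm_le_const (μ := ν) (f := fun v => F (Fin.cons v y))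
        (C := C) (Filter.Eventually.of_forall fun v => hC _)
      simpa using this
    have hG0 := ih G (fun q => A q.succ) hGm ⟨C, hGC⟩ (fun q => hA q.succ) (by
      intro q y v
      have hconst : G (Function.update y q v) + (A q.succ).indicator (fun _ => b) (y q) =
          ∫ w, (F (Fin.cons w (Function.update y q v)) +
            (A q.succ).indicator (fun _ => b) (y q)) ∂ν := by
        rw [integral_add (hint _) (integrable_const _)]
        simp [hG]
      rw [hconst]
      refine integral_mono (hint y) ((hint _).add (integrable_const _)) fun w => ?_
      have := h q.succ (Fin.cons w y) v
      rwa [← Fin.cons_update, Fin.cons_succ] at this)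
    have hexpint : Integrable (fun z : (Fin N → α) × α => Real.exp (η * F (Fin.cons z.2 z.1)))
        (π.prod ν) := integrable_exp_of_abs_le hFc (fun z => hC _) hη
    have hE : 0 ≤ Real.exp (η ^ 2 * b ^ 2 * ν.real (A 0)) := (Real.exp_pos _).le
    rw [htr, htr, integral_prod _ hexpint,
      integral_prod _ (integrable_of_abs_le hFc fun z => hC _)]
    calc ∫ y, ∫ v, Real.exp (η * F (Fin.cons v y)) ∂ν ∂π
        ≤ ∫ y, Real.exp (η * G y) * Real.exp (η ^ 2 * b ^ 2 * ν.real (A 0)) ∂π := by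
          refine integral_mono hexpint.integral_prod_left
            ((integrable_exp_of_abs_le hGm hGC hη).mul_const _) fun y => ?_
          refine (integral_exp_le (hFy y) (fun v => hC _) (hA 0) hη hηb ?_).trans_eq
            (Real.exp_add _ _)
          intro v v'
          have := h 0 (Fin.cons v y) v'
          rwa [Fin.update_cons_zero, Fin.cons_zero] at this
      _ ≤ Real.exp (η * ∫ y, G y ∂π + η ^ 2 * b ^ 2 * ∑ q : Fin N, ν.real (A q.succ)) *
            Real.exp (η ^ 2 * b ^ 2 * ν.real (A 0)) := by
          rw [integral_mul_const]
          exact mul_le_mul_of_nonneg_right hG0 hE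
      _ = _ := by
          rw [← Real.exp_add, Fin.sum_univ_succ]
          congr 1
          ring

end Tensor

/-! ### Concentration of the total excess -/

section Concentration

variable {α : Type*} {N : ℕ} {Y : Fin N → ℕ → Set α}

/-- The number of indices `q` for which the event `Y q t` occurs. -/
def eventCount (Y : Fin N → ℕ → Set α) (t : ℕ) (x : Fin N → α) : ℝ :=
  ∑ q, (Y q t).indicator (fun _ => (1 : ℝ)) (x q)

lemma indicator_one_nonneg (A : Set α) (v : α) : 0 ≤ A.indicator (fun _ => (1 : ℝ)) v :=
  Set.indicator_nonneg (fun _ _ => zero_le_one) v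

lemma eventCount_nonneg (t : ℕ) (x : Fin N → α) : 0 ≤ eventCount Y t x :=
  Finset.sum_nonneg fun _ _ => indicator_one_nonneg _ _

lemma eventCount_le (t : ℕ) (x : Fin N → α) : eventCount Y t x ≤ N := by
  calc eventCount Y t x ≤ ∑ _q : Fin N, (1 : ℝ) :=
        Finset.sum_le_sum fun q _ => Set.indicator_le_self' (fun _ _ => zero_le_one) _
    _ = N := by simp

lemma eventCount_update (t : ℕ) (q : Fin N) (x : Fin N → α) (v : α) :
    eventCount Y t x ≤
      eventCount Y t (Function.update x q v) + (Y q t).indicator (fun _ => (1 : ℝ)) (x q) := by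
  unfold eventCount
  rw [← Finset.add_sum_erase _ _ (Finset.mem_univ q),
    ← Finset.add_sum_erase _ (fun q' => (Y q' t).indicator _ (Function.update x q v q'))
      (Finset.mem_univ q)]
  have : ∑ q' ∈ Finset.univ.erase q, (Y q' t).indicator (fun _ => (1 : ℝ)) (x q') =
      ∑ q' ∈ Finset.univ.erase q,
        (Y q' t).indicator (fun _ => (1 : ℝ)) (Function.update x q v q') :=
    Finset.sum_congr rfl fun q' hq' => by
      rw [Function.update_of_ne (Finset.ne_of_mem_erase hq')]
  rw [this]
  have := indicator_one_nonneg (Y q t) (Function.update x q v q)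
  linarith

section Excess

variable {p : ℕ} {ε : ℝ}

lemma excess_mono : Monotone (excess p ε) := fun x y h => by
  unfold excess
  gcongr

lemma excess_nonneg (x : ℝ) : 0 ≤ excess p ε x := le_max_right _ _

lemma excess_add_le (x : ℝ) {y : ℝ} (hy : 0 ≤ y) : excess p ε (x + y) ≤ excess p ε x + y := by
  refine max_le ?_ (add_nonneg (excess_nonneg x) hy)
  have : x - (1 - ε / 2) * p ≤ excess p ε x := le_max_left _ _
  linarith

lemma measurable_excess : Measurable (excess p ε) := by
  unfold excess
  fun_prop

end Excess

variable {p d : ℕ} {ε : ℝ}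

lemma abs_excess_eventCount_le (hε1 : ε ≤ 1) (t : ℕ) (x : Fin N → α) :
    |excess p ε (eventCount Y t x)| ≤ N := by
  rw [abs_of_nonneg (excess_nonneg _)]
  refine max_le ?_ N.cast_nonneg
  have := eventCount_le (Y := Y) t x
  have : 0 ≤ (1 - ε / 2) * p := mul_nonneg (by linarith) p.cast_nonneg
  linarith

variable [MeasurableSpace α]

lemma measurable_eventCount (hY : ∀ q t, MeasurableSet (Y q t)) (t : ℕ) :
    Measurable (eventCount Y t) := by
  unfold eventCount
  exact Finset.measurable_sum _ fun q _ =>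
    (measurable_const.indicator (hY q t)).comp (measurable_pi_apply q)

variable {ν : Measure α} [IsProbabilityMeasure ν]

lemma integral_eventCount (hY : ∀ q t, MeasurableSet (Y q t)) (t : ℕ) :
    ∫ x, eventCount Y t x ∂(Measure.pi fun _ : Fin N => ν) = ∑ q, ν.real (Y q t) := by
  have hm : ∀ q, Measurable ((Y q t).indicator (fun _ => (1 : ℝ))) := fun q =>
    measurable_const.indicator (hY q t)
  unfold eventCount
  rw [integral_finsetSum]
  · refine Finset.sum_congr rfl fun q _ => ?_
    rw [integral_comp_eval (μ := fun _ : Fin N => ν) (f := (Y q t).indicator (fun _ => (1 : ℝ)))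
      (hm q).aestronglyMeasurable, integral_indicator_const _ (hY q t)]
    simp
  · intro q _
    refine integrable_of_abs_le ((hm q).comp (measurable_pi_apply q)) (C := 1) fun x => ?_
    rw [abs_of_nonneg (indicator_one_nonneg _ _)]
    exact Set.indicator_le_self' (fun _ _ => zero_le_one) _

/-- Bound the excess by an exponential with rate `ε/4`: the gap `ε p / 2` between mean and cutoff
contributes `-ε² p / 8`, which beats the variance term of at most `ε² p / 16`. -/
lemma integral_excess_le (hY : ∀ q t, MeasurableSet (Y q t)) (hε : 0 < ε) (hε1 : ε ≤ 1) {t : ℕ}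
    (hmean : ∑ q, ν.real (Y q t) ≤ (1 - ε) * p) :
    ∫ x, excess p ε (eventCount Y t x) ∂(Measure.pi fun _ : Fin N => ν) ≤ 4 / ε := by
  have hm := measurable_eventCount hY t
  have habs : ∀ x, |eventCount Y t x| ≤ N := fun x => by
    rw [abs_of_nonneg (eventCount_nonneg t x)]
    exact eventCount_le t x
  have h1 := integral_exp_pi_le (ν := ν) (b := 1) (η := ε / 4) (by positivity) (by linarith) N
    (eventCount Y t) (fun q => Y q t) hm ⟨N, habs⟩ (fun q => hY q t)
    (fun q x v => eventCount_update t q x v)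
  rw [integral_eventCount hY] at h1
  have hη : 0 < ε / 4 := by positivity
  have hpt : ∀ x : Fin N → α, excess p ε (eventCount Y t x) ≤
      4 / ε * Real.exp (-(ε / 4 * ((1 - ε / 2) * p))) * Real.exp (ε / 4 * eventCount Y t x) := by
    intro x
    rw [mul_assoc, ← Real.exp_add]
    set z := -(ε / 4 * ((1 - ε / 2) * p)) + ε / 4 * eventCount Y t x with hz
    refine max_le ?_ (by positivity)
    have h2 : eventCount Y t x - (1 - ε / 2) * p = 4 / ε * z := by
      rw [hz]; field_simp; ring
    rw [h2]
    gcongr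
    linarith [Real.add_one_le_exp z]
  calc ∫ x, excess p ε (eventCount Y t x) ∂(Measure.pi fun _ : Fin N => ν)
      ≤ ∫ x, 4 / ε * Real.exp (-(ε / 4 * ((1 - ε / 2) * p))) *
          Real.exp (ε / 4 * eventCount Y t x) ∂(Measure.pi fun _ : Fin N => ν) :=
        integral_mono (integrable_of_abs_le (measurable_excess.comp hm)
          (abs_excess_eventCount_le hε1 t))
          ((integrable_exp_of_abs_le hm habs hη.le).const_mul _) hpt
    _ ≤ 4 / ε * Real.exp (-(ε / 4 * ((1 - ε / 2) * p))) *
          Real.exp (ε / 4 * ((1 - ε) * p) + (ε / 4) ^ 2 * 1 ^ 2 * ((1 - ε) * p)) := by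
        rw [integral_const_mul]
        refine mul_le_mul_of_nonneg_left (h1.trans ?_) (by positivity)
        gcongr
    _ ≤ 4 / ε * 1 := by
        rw [mul_assoc, ← Real.exp_add]
        refine mul_le_mul_of_nonneg_left (Real.exp_le_one_iff.2 ?_) (by positivity)
        have h3 : 0 ≤ ε ^ 2 * p := by positivity
        have h4 : 0 ≤ ε * (ε ^ 2 * p) := by positivity
        nlinarith
    _ = 4 / ε := mul_one _

/-- Concentration of the total excess over the times in `T`. -/
lemma measureReal_excess_le (hY : ∀ q t, MeasurableSet (Y q t)) (hε : 0 < ε) (hε1 : ε ≤ 1)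
    (hd : 0 < d) (hεp : 32 ≤ ε ^ 2 * p) {T : Finset ℕ}
    (hmean : ∀ t ∈ T, ∑ q, ν.real (Y q t) ≤ (1 - ε) * p)
    (hcount : ∀ q v, ∑ t ∈ T, (Y q t).indicator (fun _ => (1 : ℝ)) v ≤ d) :
    (Measure.pi fun _ : Fin N => ν).real
        {x | ε * p * T.card / 4 ≤ ∑ t ∈ T, excess p ε (eventCount Y t x)} ≤
      Real.exp (-(T.card / (8 * (d : ℝ) ^ 2))) := by
  set F : (Fin N → α) → ℝ := fun x => ∑ t ∈ T, excess p ε (eventCount Y t x) with hF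
  set A : Fin N → Set α := fun q => ⋃ t ∈ T, Y q t with hA
  have hd' : (1 : ℝ) ≤ d := by exact_mod_cast hd
  have hd0 : (0 : ℝ) < d := by linarith
  have hm : Measurable F :=
    Finset.measurable_sum _ fun t _ => measurable_excess.comp (measurable_eventCount hY t)
  have habs : ∀ x, |F x| ≤ T.card * N := fun x => by
    refine (Finset.abs_sum_le_sum_abs _ _).trans ?_
    refine (Finset.sum_le_sum fun t _ => abs_excess_eventCount_le hε1 t x).trans_eq ?_
    simp
  have hAm : ∀ q, MeasurableSet (A q) := fun q =>
    Finset.measurableSet_biUnion _ fun t _ => hY q t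
  have hupd : ∀ q x v,
      F x ≤ F (Function.update x q v) + (A q).indicator (fun _ => (d : ℝ)) (x q) := by
    intro q x v
    have h1 : F x ≤ F (Function.update x q v) +
        ∑ t ∈ T, (Y q t).indicator (fun _ => (1 : ℝ)) (x q) := by
      rw [hF, ← Finset.sum_add_distrib]
      exact Finset.sum_le_sum fun t _ => (excess_mono (eventCount_update t q x v)).trans
        (excess_add_le _ (indicator_one_nonneg _ _))
    refine h1.trans (add_le_add le_rfl ?_)
    by_cases hx : x q ∈ A q
    · rw [Set.indicator_of_mem hx]
      exact hcount q (x q)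
    · rw [Set.indicator_of_notMem hx]
      refine (Finset.sum_eq_zero fun t ht => Set.indicator_of_notMem (fun h => hx ?_) _).le
      exact Set.mem_biUnion ht h
  have hp : (0 : ℝ) ≤ p := p.cast_nonneg
  have hηd : ε / (16 * (d : ℝ) ^ 2) * d ≤ 1 := by
    rw [div_mul_eq_mul_div, div_le_one (by positivity)]
    nlinarith
  have hη : 0 ≤ ε / (16 * (d : ℝ) ^ 2) := by positivity
  have hmgf := integral_exp_pi_le (ν := ν) hη hηd N F A hm ⟨_, habs⟩ hAm hupd
  have hEF : ∫ x, F x ∂(Measure.pi fun _ : Fin N => ν) ≤ T.card * (4 / ε) := by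
    rw [hF, integral_finsetSum]
    · refine (Finset.sum_le_sum fun t ht => integral_excess_le hY hε hε1 (hmean t ht)).trans_eq ?_
      simp
    · intro t _
      exact integrable_of_abs_le (measurable_excess.comp (measurable_eventCount hY t))
        (abs_excess_eventCount_le hε1 t)
  -- This keeps the variance term proportional to the window length and `p`, whatever the number `N`
  -- of variables.
  have hAsum : ∑ q, ν.real (A q) ≤ T.card * p := by
    calc ∑ q, ν.real (A q) ≤ ∑ q, ∑ t ∈ T, ν.real (Y q t) :=
          Finset.sum_le_sum fun q _ => measureReal_biUnion_finset_le _ _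
      _ = ∑ t ∈ T, ∑ q, ν.real (Y q t) := Finset.sum_comm
      _ ≤ ∑ t ∈ T, (p : ℝ) := Finset.sum_le_sum fun t ht => (hmean t ht).trans (by nlinarith)
      _ = T.card * p := by simp
  refine (measure_ge_le_exp_mul_mgf (X := F) _ hη
    (integrable_exp_of_abs_le hm habs hη)).trans ?_
  refine (mul_le_mul_of_nonneg_left hmgf (Real.exp_pos _).le).trans ?_
  rw [← Real.exp_add, Real.exp_le_exp]
  set ℓ : ℝ := (T.card : ℝ)
  have hℓ : 0 ≤ ℓ := Nat.cast_nonneg _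
  set η := ε / (16 * (d : ℝ) ^ 2) with hηdef
  -- This is exactly `32 ≤ ε ^ 2 * p`. Mean and variance then use `1/8` and `1/16` of the available
  -- `1/4`, leaving `1/16` for the tail.
  have h4 : 4 / ε ≤ ε * p / 8 := by
    rw [div_le_iff₀ hε]
    nlinarith
  have hEF' : η * ∫ x, F x ∂(Measure.pi fun _ : Fin N => ν) ≤ η * (ℓ * (ε * p / 8)) := by
    gcongr
    exact hEF.trans (by gcongr)
  have hη2 : η ^ 2 * (d : ℝ) ^ 2 = η * ε / 16 := by
    rw [hηdef]; field_simp
  have hA' : η ^ 2 * (d : ℝ) ^ 2 * ∑ q, ν.real (A q) ≤ η * ε / 16 * (ℓ * p) := by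
    rw [hη2]
    gcongr
  have hfin : ℓ / (8 * (d : ℝ) ^ 2) ≤ η * (ℓ * (ε * p / 16)) := by
    have : η * (ℓ * (ε * p / 16)) = ℓ / (8 * (d : ℝ) ^ 2) * (ε ^ 2 * p / 32) := by
      rw [hηdef]; field_simp; ring
    rw [this]
    refine le_mul_of_one_le_right (by positivity) ?_
    linarith
  have e1 : η * ε / 16 * (ℓ * p) = η * (ℓ * (ε * p / 16)) := by ring
  have e2 : η * (ℓ * (ε * p / 8)) = 2 * (η * (ℓ * (ε * p / 16))) := by ring
  have e3 : -η * (ε * p * ℓ / 4) = -(4 * (η * (ℓ * (ε * p / 16)))) := by ring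
  rw [e3]
  rw [e1] at hA'
  rw [e2] at hEF'
  linarith

end Concentration

/-! ### Random thresholds in an interval -/

/-- The values of the `m`-th threshold collection for which one of its thresholds lies in
`(x, y]`. -/
def thresholdEvent (d m : ℕ) (x y : ℝ) : Set ℝ :=
  ⋃ u ∈ Finset.Icc 1 d, Set.Ioc (x - (m * (d + 1) + 1 + u : ℕ)) (y - (m * (d + 1) + 1 + u : ℕ))

lemma measurableSet_thresholdEvent (d m : ℕ) (x y : ℝ) :
    MeasurableSet (thresholdEvent d m x y) :=
  Finset.measurableSet_biUnion _ fun _ _ => measurableSet_Ioc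

lemma mem_thresholdEvent {d m : ℕ} {x y : ℝ} (s : ℕ → ℝ) :
    s m ∈ thresholdEvent d m x y ↔
      ∃ u : ℕ, 1 ≤ u ∧ u ≤ d ∧ x < threshold d s m u ∧ threshold d s m u ≤ y := by
  simp only [thresholdEvent, Set.mem_iUnion, Finset.mem_Icc, Set.mem_Ioc, threshold,
    sub_lt_iff_lt_add', le_sub_iff_add_le']
  constructor
  · rintro ⟨u, ⟨h1, h2⟩, h3, h4⟩
    exact ⟨u, h1, h2, h3, h4⟩
  · rintro ⟨u, h1, h2, h3, h4⟩
    exact ⟨u, ⟨h1, h2⟩, h3, h4⟩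

open Classical in
lemma crosses_le_sum_thresholdEvent {d : ℕ} {s : ℕ → ℝ} (hs : ∀ m, 0 < s m) {x y : ℝ} {M : ℕ}
    (hy : y ≤ M) :
    (if Crosses d s x y then (1 : ℝ) else 0) ≤
      ∑ m : Fin M, (thresholdEvent d m x y).indicator (fun _ => (1 : ℝ)) (s m) := by
  have h0 : ∀ m ∈ Finset.univ (α := Fin M),
      0 ≤ (thresholdEvent d m x y).indicator (fun _ => (1 : ℝ)) (s m) :=
    fun m _ => indicator_one_nonneg _ _
  split_ifs with h
  · obtain ⟨m, u, h1, h2, h3, h4⟩ := h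
    have hm : m < M := by
      have h5 : ((m * (d + 1) + 1 + u : ℕ) : ℝ) + s m ≤ M := h4.trans hy
      have h6 : ((m * (d + 1) + 1 + u : ℕ) : ℝ) < M := by linarith [hs m]
      have h7 : m * (d + 1) + 1 + u < M := by exact_mod_cast h6
      nlinarith
    refine le_trans ?_ (Finset.single_le_sum h0 (Finset.mem_univ ⟨m, hm⟩))
    rw [Set.indicator_of_mem]
    exact (mem_thresholdEvent s).2 ⟨u, h1, h2, h3, h4⟩
  · exact Finset.sum_nonneg h0

lemma pairwise_disjoint_Ioc_natCast :
    Pairwise (Function.onFun Disjoint fun k : ℕ => Set.Ioc (k : ℝ) (k + 1)) := by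
  intro k l hkl
  rw [Function.onFun, Set.disjoint_left]
  rintro v ⟨h1, h2⟩ ⟨h3, h4⟩
  have h5 : (k : ℝ) < l + 1 := by linarith
  have h6 : (l : ℝ) < k + 1 := by linarith
  have h7 : k < l + 1 := by exact_mod_cast h5
  have h8 : l < k + 1 := by exact_mod_cast h6
  omega

lemma restrict_Ioc_sub (x y : ℝ) (k : ℕ) :
    (volume.restrict (Set.Ioc (0 : ℝ) 1)).real (Set.Ioc (x - k) (y - k)) =
      volume.real (Set.Ioc x y ∩ Set.Ioc (k : ℝ) (k + 1)) := by
  rw [measureReal_restrict_apply measurableSet_Ioc, Set.Ioc_inter_Ioc, Set.Ioc_inter_Ioc,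
    measureReal_def, measureReal_def, Real.volume_Ioc, Real.volume_Ioc]
  congr 2
  have h1 : max (x - k) 0 = max x k - k := by
    rw [← max_sub_sub_right, sub_self]
  have h2 : min (y - k) 1 = min y (k + 1) - k := by
    rw [← min_sub_sub_right, add_sub_cancel_left]
  rw [h1, h2]
  ring

/-- Each threshold is uniform on its own unit interval and these intervals are disjoint, so the
union bound sums to at most the length of `(x, y]`. -/
lemma sum_measureReal_thresholdEvent_le (d M : ℕ) {x y : ℝ} (hxy : x ≤ y) :
    ∑ m : Fin M, (volume.restrict (Set.Ioc (0 : ℝ) 1)).real (thresholdEvent d m x y) ≤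
      y - x := by
  have hinj : Function.Injective
      fun z : Fin M × Fin d => (z.1 : ℕ) * (d + 1) + 1 + ((z.2 : ℕ) + 1) := by
    rintro ⟨m, u⟩ ⟨m', u'⟩ h
    simp only at h
    have hu := u.2
    have hu' := u'.2
    have h1 : (m : ℕ) = m' := by
      rcases lt_trichotomy (m : ℕ) m' with h' | h' | h'
      · nlinarith [Nat.mul_le_mul_right (d + 1) h']
      · exact h'
      · nlinarith [Nat.mul_le_mul_right (d + 1) h']
    rw [h1] at h
    ext
    · exact h1
    · simp only; omega
  calc ∑ m : Fin M, (volume.restrict (Set.Ioc (0 : ℝ) 1)).real (thresholdEvent d m x y)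
      ≤ ∑ m : Fin M, ∑ u ∈ Finset.Icc 1 d,
          volume.real (Set.Ioc x y ∩ Set.Ioc ((m * (d + 1) + 1 + u : ℕ) : ℝ)
            ((m * (d + 1) + 1 + u : ℕ) + 1)) := by
        refine Finset.sum_le_sum fun m _ => (measureReal_biUnion_finset_le _ _).trans_eq ?_
        exact Finset.sum_congr rfl fun u _ => restrict_Ioc_sub x y _
    _ = ∑ z : Fin M × Fin d,
          volume.real (Set.Ioc x y ∩ Set.Ioc ((z.1 * (d + 1) + 1 + (z.2 + 1) : ℕ) : ℝ)
            ((z.1 * (d + 1) + 1 + (z.2 + 1) : ℕ) + 1)) := by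
        rw [Fintype.sum_prod_type]
        refine Finset.sum_congr rfl fun m _ => ?_
        have hIcc : Finset.Icc 1 d = Finset.Ico 1 (d + 1) := by ext; simp
        rw [hIcc, Finset.sum_Ico_eq_sum_range, Nat.add_sub_cancel, Finset.sum_range]
        exact Finset.sum_congr rfl fun u _ => by rw [add_comm 1 (u : ℕ)]
    _ = volume.real (⋃ z ∈ Finset.univ (α := Fin M × Fin d),
          Set.Ioc x y ∩ Set.Ioc ((z.1 * (d + 1) + 1 + (z.2 + 1) : ℕ) : ℝ)
            ((z.1 * (d + 1) + 1 + (z.2 + 1) : ℕ) + 1)) := by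
        rw [measureReal_biUnion_finset
          (h := fun z _ => measure_ne_top_of_subset Set.inter_subset_left measure_Ioc_lt_top.ne)]
        · intro z _ z' _ hz
          exact (pairwise_disjoint_Ioc_natCast (hinj.ne hz)).mono Set.inter_subset_right
            Set.inter_subset_right
        · exact fun z _ => measurableSet_Ioc.inter measurableSet_Ioc
    _ ≤ volume.real (Set.Ioc x y) :=
        measureReal_mono (Set.iUnion₂_subset fun z _ => Set.inter_subset_left)
          measure_Ioc_lt_top.ne
    _ = y - x := by
        rw [measureReal_def, Real.volume_Ioc, ENNReal.toReal_ofReal (by linarith)]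

/-- A collection has `d` thresholds, and each lies in at most one of the disjoint intervals between
successive poured amounts. This is the influence bound `d` of one random value. -/
lemma sum_indicator_thresholdEvent_le (d m : ℕ) {a : ℕ → ℝ} (ha : Monotone a) (T : Finset ℕ)
    (v : ℝ) :
    ∑ t ∈ T, (thresholdEvent d m (a t) (a (t + 1))).indicator (fun _ => (1 : ℝ)) v ≤ d := by
  classical
  have hterm : ∀ t, (thresholdEvent d m (a t) (a (t + 1))).indicator (fun _ => (1 : ℝ)) v ≤
      ∑ u ∈ Finset.Icc 1 d, (Set.Ioc (a t - (m * (d + 1) + 1 + u : ℕ))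
        (a (t + 1) - (m * (d + 1) + 1 + u : ℕ))).indicator (fun _ => (1 : ℝ)) v := by
    intro t
    by_cases h : v ∈ thresholdEvent d m (a t) (a (t + 1))
    · rw [Set.indicator_of_mem h]
      simp only [thresholdEvent, Set.mem_iUnion] at h
      obtain ⟨u, hu, hv⟩ := h
      refine le_trans ?_ (Finset.single_le_sum (fun u _ => indicator_one_nonneg _ _) hu)
      rw [Set.indicator_of_mem hv]
    · rw [Set.indicator_of_notMem h]
      exact Finset.sum_nonneg fun u _ => indicator_one_nonneg _ _
  have hone : ∀ k : ℕ, ∑ t ∈ T,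
      (Set.Ioc (a t - k) (a (t + 1) - k)).indicator (fun _ => (1 : ℝ)) v ≤ 1 := by
    intro k
    simp only [Set.indicator_apply]
    rw [Finset.sum_boole]
    have : (T.filter fun t => v ∈ Set.Ioc (a t - k) (a (t + 1) - k)).card ≤ 1 := by
      refine Finset.card_le_one.2 fun t ht t' ht' => ?_
      simp only [Finset.mem_filter, Set.mem_Ioc] at ht ht'
      rcases lt_trichotomy t t' with h | h | h
      · linarith [ha (Nat.succ_le_of_lt h)]
      · exact h
      · linarith [ha (Nat.succ_le_of_lt h)]
    exact_mod_cast this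
  calc _ ≤ ∑ t ∈ T, ∑ u ∈ Finset.Icc 1 d, (Set.Ioc (a t - (m * (d + 1) + 1 + u : ℕ))
        (a (t + 1) - (m * (d + 1) + 1 + u : ℕ))).indicator (fun _ => (1 : ℝ)) v :=
        Finset.sum_le_sum fun t _ => hterm t
    _ = ∑ u ∈ Finset.Icc 1 d, ∑ t ∈ T, (Set.Ioc (a t - (m * (d + 1) + 1 + u : ℕ))
        (a (t + 1) - (m * (d + 1) + 1 + u : ℕ))).indicator (fun _ => (1 : ℝ)) v :=
        Finset.sum_comm
    _ ≤ ∑ u ∈ Finset.Icc 1 d, (1 : ℝ) := Finset.sum_le_sum fun u _ => hone _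
    _ = d := by simp

lemma poured_mono {n p : ℕ} {ε : ℝ} {c : ℕ → Fin n → ℝ} (hc : IsPouring n p ε c) (j : Fin n) :
    Monotone fun t => poured c t j :=
  monotone_nat_of_le_succ fun t => by
    rw [poured_succ]
    linarith [hc.nonneg t j]

lemma poured_le {n p : ℕ} {ε : ℝ} {c : ℕ → Fin n → ℝ} (hc : IsPouring n p ε c) (t : ℕ)
    (j : Fin n) : poured c t j ≤ t := by
  refine (Finset.sum_le_sum fun τ _ => hc.le_one τ j).trans_eq ?_
  simp

/-! ### Probability of an excess window and the union bound -/

section Window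

variable {n p d : ℕ} {ε : ℝ} {c : ℕ → Fin n → ℝ}

/-- The event that cup `j` crosses a threshold of its `m`-th collection in the `(t+1)`-st step,
where the pair `(j, m)` is encoded by `q`. -/
def crossEvent (d : ℕ) (c : ℕ → Fin n → ℝ) (M : ℕ) (q : Fin (n * M)) (t : ℕ) : Set ℝ :=
  thresholdEvent d (finProdFinEquiv.symm q).2 (poured c t (finProdFinEquiv.symm q).1)
    (poured c (t + 1) (finProdFinEquiv.symm q).1)

lemma sum_measureReal_crossEvent_le (hc : IsPouring n p ε c) (M t : ℕ) :
    ∑ q, (volume.restrict (Set.Ioc (0 : ℝ) 1)).real (crossEvent d c M q t) ≤ (1 - ε) * p := by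
  unfold crossEvent
  rw [Equiv.sum_comp finProdFinEquiv.symm fun z : Fin n × Fin M =>
    (volume.restrict (Set.Ioc (0 : ℝ) 1)).real
      (thresholdEvent d z.2 (poured c t z.1) (poured c (t + 1) z.1)), Fintype.sum_prod_type]
  refine (Finset.sum_le_sum fun j _ => ?_).trans (hc.sum_le t)
  refine (sum_measureReal_thresholdEvent_le d M (poured_mono hc j (Nat.le_succ t))).trans_eq ?_
  simp only [Nat.succ_eq_add_one, poured_succ, add_sub_cancel_left]

lemma arrivals_le_eventCount (hc : IsPouring n p ε c) {s : Fin n → ℕ → ℝ}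
    (hs : ∀ j m, 0 < s j m) {M t : ℕ} (ht : t < M) :
    arrivals d c s t ≤ eventCount (crossEvent d c M) t fun q =>
      s (finProdFinEquiv.symm q).1 (finProdFinEquiv.symm q).2 := by
  unfold eventCount crossEvent
  rw [Equiv.sum_comp finProdFinEquiv.symm fun z : Fin n × Fin M =>
    (thresholdEvent d z.2 (poured c t z.1) (poured c (t + 1) z.1)).indicator
      (fun _ => (1 : ℝ)) (s z.1 z.2), Fintype.sum_prod_type]
  refine Finset.sum_le_sum fun j _ => crosses_le_sum_thresholdEvent (hs j) ?_
  exact (poured_le hc (t + 1) j).trans (by exact_mod_cast ht)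

variable {Ω : Type*} [MeasurableSpace Ω] {μ : Measure Ω}

lemma map_eq_restrict_of_isUniform {X : Ω → ℝ} (h : pdf.IsUniform X (Set.Ioc 0 1) μ volume) :
    μ.map X = volume.restrict (Set.Ioc (0 : ℝ) 1) := by
  rw [pdf.IsUniform] at h
  rw [h, ProbabilityTheory.cond, Real.volume_Ioc]
  simp

lemma isProbabilityMeasure_restrict_Ioc :
    IsProbabilityMeasure (volume.restrict (Set.Ioc (0 : ℝ) 1)) :=
  ⟨by simp⟩

variable {s : Fin n → ℕ → Ω → ℝ}

lemma ae_mem_Ioc (hm : ∀ j m, Measurable (s j m))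
    (hu : ∀ j m, pdf.IsUniform (s j m) (Set.Ioc 0 1) μ volume) :
    ∀ᵐ ω ∂μ, ∀ j m, 0 < s j m ω ∧ s j m ω ≤ 1 := by
  rw [ae_all_iff]
  intro j
  rw [ae_all_iff]
  intro m
  have h : ∀ᵐ v ∂(μ.map (s j m)), v ∈ Set.Ioc (0 : ℝ) 1 := by
    rw [map_eq_restrict_of_isUniform (hu j m)]
    exact ae_restrict_mem measurableSet_Ioc
  exact ae_of_ae_map (hm j m).aemeasurable h

variable [IsProbabilityMeasure μ]

lemma map_eq_pi (hm : ∀ j m, Measurable (s j m))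
    (hu : ∀ j m, pdf.IsUniform (s j m) (Set.Ioc 0 1) μ volume)
    (hi : iIndepFun (fun q : Fin n × ℕ => s q.1 q.2) μ) (M : ℕ) :
    μ.map (fun ω (q : Fin (n * M)) =>
      s (finProdFinEquiv.symm q).1 (finProdFinEquiv.symm q).2 ω) =
      Measure.pi fun _ => volume.restrict (Set.Ioc (0 : ℝ) 1) := by
  have hinj : Function.Injective fun q : Fin (n * M) =>
      ((finProdFinEquiv.symm q).1, ((finProdFinEquiv.symm q).2 : ℕ)) := by
    intro q q' h
    simp only [Prod.mk.injEq] at h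
    exact finProdFinEquiv.symm.injective (Prod.ext h.1 (Fin.ext h.2))
  have h := (iIndepFun_iff_map_fun_eq_pi_map fun q : Fin (n * M) =>
    (hm (finProdFinEquiv.symm q).1 (finProdFinEquiv.symm q).2).aemeasurable).1
      (hi.precomp hinj)
  refine h.trans ?_
  congr 1
  funext q
  exact map_eq_restrict_of_isUniform (hu _ _)

lemma measure_window_le (hc : IsPouring n p ε c) (hε : 0 < ε) (hε1 : ε ≤ 1) (hd : 0 < d)
    (hεp : 32 ≤ ε ^ 2 * p) (hm : ∀ j m, Measurable (s j m))
    (hu : ∀ j m, pdf.IsUniform (s j m) (Set.Ioc 0 1) μ volume)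
    (hi : iIndepFun (fun q : Fin n × ℕ => s q.1 q.2) μ) (t i : ℕ) :
    μ {ω | (∀ j m, 0 < s j m ω ∧ s j m ω ≤ 1) ∧ ε * p * (i - t : ℕ) / 4 ≤
        ∑ τ ∈ Finset.Ico t i, excess p ε (arrivals d c (fun j m => s j m ω) τ)} ≤
      ENNReal.ofReal (Real.exp (-((i - t : ℕ) / (8 * (d : ℝ) ^ 2)))) := by
  have := isProbabilityMeasure_restrict_Ioc
  have hY : ∀ q τ, MeasurableSet (crossEvent d c i q τ) := fun q τ =>
    measurableSet_thresholdEvent _ _ _ _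
  -- `i` collections per cup suffice: at most `i` units reach a cup in `i` steps, and collection `m`
  -- lies above level `m`.
  have hconc := measureReal_excess_le (ν := volume.restrict (Set.Ioc (0 : ℝ) 1)) hY hε hε1 hd hεp
    (T := Finset.Ico t i) (fun τ _ => sum_measureReal_crossEvent_le hc i τ)
    fun q v => sum_indicator_thresholdEvent_le d _ (poured_mono hc _) _ v
  rw [Nat.card_Ico] at hconc
  have hX : Measurable fun ω (q : Fin (n * i)) =>
      s (finProdFinEquiv.symm q).1 (finProdFinEquiv.symm q).2 ω :=
    measurable_pi_iff.2 fun q => hm _ _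
  have hmeas : MeasurableSet {x : Fin (n * i) → ℝ | ε * p * (i - t : ℕ) / 4 ≤
      ∑ τ ∈ Finset.Ico t i, excess p ε (eventCount (crossEvent d c i) τ x)} :=
    measurableSet_le measurable_const
      (Finset.measurable_sum _ fun τ _ => measurable_excess.comp (measurable_eventCount hY τ))
  rw [← map_eq_pi hm hu hi, measureReal_def, Measure.map_apply hX hmeas] at hconc
  refine le_trans (measure_mono ?_)
    ((ENNReal.le_ofReal_iff_toReal_le (measure_ne_top μ _) (Real.exp_pos _).le).2 hconc)
  rintro ω ⟨hω, hle⟩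
  refine hle.trans (Finset.sum_le_sum fun τ hτ => excess_mono ?_)
  exact arrivals_le_eventCount hc (fun j m => (hω j m).1) (Finset.mem_Ico.1 hτ).2

/-- Half of the decay rate makes the series geometric; the other half retains the factor `exp (-(γ *
L))`. -/
lemma sum_exp_le {γ : ℝ} (hγ : 0 < γ) (hγ1 : γ ≤ 1 / 2) (L : ℝ) (i : ℕ) :
    ∑ t ∈ (Finset.range (i + 1)).filter (fun t => L ≤ (i - t : ℕ)),
      Real.exp (-(2 * γ * (i - t : ℕ))) ≤ 2 / γ * Real.exp (-(γ * L)) := by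
  have h1 : 1 - Real.exp (-γ) ≥ γ / 2 := by
    have := (abs_le.1 (Real.abs_exp_sub_one_sub_id_le (x := -γ)
      (by rw [abs_neg, abs_of_pos hγ]; linarith))).2
    nlinarith
  have hr0 : 0 ≤ Real.exp (-γ) := (Real.exp_pos _).le
  have hr1 : Real.exp (-γ) < 1 := by linarith
  calc ∑ t ∈ (Finset.range (i + 1)).filter (fun t => L ≤ (i - t : ℕ)),
        Real.exp (-(2 * γ * (i - t : ℕ)))
      ≤ ∑ t ∈ (Finset.range (i + 1)).filter (fun t => L ≤ (i - t : ℕ)),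
          Real.exp (-γ) ^ (i - t) * Real.exp (-(γ * L)) := by
        refine Finset.sum_le_sum fun t ht => ?_
        rw [← Real.exp_nat_mul, ← Real.exp_add, Real.exp_le_exp]
        nlinarith [(Finset.mem_filter.1 ht).2]
    _ ≤ ∑ t ∈ Finset.range (i + 1), Real.exp (-γ) ^ (i - t) * Real.exp (-(γ * L)) :=
        Finset.sum_le_sum_of_subset_of_nonneg (Finset.filter_subset _ _)
          fun _ _ _ => by positivity
    _ = (∑ t ∈ Finset.range (i + 1), Real.exp (-γ) ^ t) * Real.exp (-(γ * L)) := by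
        rw [← Finset.sum_mul, ← Finset.sum_range_reflect fun t => Real.exp (-γ) ^ t]
        rfl
    _ ≤ 2 / γ * Real.exp (-(γ * L)) := by
        refine mul_le_mul_of_nonneg_right ?_ (Real.exp_pos _).le
        refine ((summable_geometric_of_lt_one hr0 hr1).sum_le_tsum _
          fun _ _ => pow_nonneg hr0 _).trans ?_
        rw [tsum_geometric_of_lt_one hr0 hr1, inv_le_comm₀ (by linarith) (by positivity), inv_div]
        exact h1

/-- The backlog tail in terms of the exponential potential. -/
lemma measure_potential_le (hp : 0 < p) (hc : IsPouring n p ε c) (hε : 0 < ε) (hε1 : ε ≤ 1 / 2)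
    (hd : 2 ≤ d) (hεp : 32 ≤ ε ^ 2 * p) (hm : ∀ j m, Measurable (s j m))
    (hu : ∀ j m, pdf.IsUniform (s j m) (Set.Ioc 0 1) μ volume)
    (hi : iIndepFun (fun q : Fin n × ℕ => s q.1 q.2) μ) {S : Ω → ℕ → Finset (Fin n)}
    (hS : ∀ ω, IsSmoothedGreedy p d c (fun j m => s j m ω) (S ω)) (i : ℕ) {L : ℝ} (hL : 0 ≤ L)
    (hLH : 7 * (6 + plateau p d ε / ε) ≤ ε * L) :
    μ {ω | plateau p d ε + maxIncrease p ε * L <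
        potential ε (state d c (fun j m => s j m ω) (S ω) i)} ≤
      ENNReal.ofReal (32 * (d : ℝ) ^ 2 * Real.exp (-(L / (16 * (d : ℝ) ^ 2)))) := by
  set I := (Finset.range (i + 1)).filter (fun t => L ≤ (i - t : ℕ)) with hI
  set W : ℕ → Set Ω := fun t => {ω | (∀ j m, 0 < s j m ω ∧ s j m ω ≤ 1) ∧
    ε * p * (i - t : ℕ) / 4 ≤
      ∑ τ ∈ Finset.Ico t i, excess p ε (arrivals d c (fun j m => s j m ω) τ)} with hW
  -- The covering events do not involve `S`, so the emptier's tie-breaking may depend on `ω`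
  -- arbitrarily, even non-measurably.
  have hsub : {ω | plateau p d ε + maxIncrease p ε * L <
      potential ε (state d c (fun j m => s j m ω) (S ω) i)} ⊆
      {ω | ¬ ∀ j m, 0 < s j m ω ∧ s j m ω ≤ 1} ∪ ⋃ t ∈ I, W t := by
    intro ω hω
    by_cases hgood : ∀ j m, 0 < s j m ω ∧ s j m ω ≤ 1
    · right
      obtain ⟨t, hti, h1, h2⟩ := exists_excess_window hp hε hε1 hd hc hgood (hS ω) hL hLH hω
      exact Set.mem_biUnion (Finset.mem_filter.2 ⟨Finset.mem_range.2 (by omega), h1⟩)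
        ⟨hgood, h2⟩
    · exact Or.inl hgood
  have hd' : (2 : ℝ) ≤ d := by exact_mod_cast hd
  have hγ : 0 < 1 / (16 * (d : ℝ) ^ 2) := by positivity
  have hγ1 : 1 / (16 * (d : ℝ) ^ 2) ≤ 1 / 2 := by
    rw [div_le_div_iff₀ (by positivity) (by norm_num)]
    nlinarith
  calc _ ≤ μ ({ω | ¬ ∀ j m, 0 < s j m ω ∧ s j m ω ≤ 1} ∪ ⋃ t ∈ I, W t) := measure_mono hsub
    _ ≤ μ {ω | ¬ ∀ j m, 0 < s j m ω ∧ s j m ω ≤ 1} + μ (⋃ t ∈ I, W t) := measure_union_le _ _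
    _ = μ (⋃ t ∈ I, W t) := by
        rw [show μ {ω | ¬ ∀ j m, 0 < s j m ω ∧ s j m ω ≤ 1} = 0 from
          ae_iff.1 (ae_mem_Ioc hm hu), zero_add]
    _ ≤ ∑ t ∈ I, μ (W t) := measure_biUnion_finset_le _ _
    _ ≤ ∑ t ∈ I, ENNReal.ofReal (Real.exp (-((i - t : ℕ) / (8 * (d : ℝ) ^ 2)))) :=
        Finset.sum_le_sum fun t _ =>
          measure_window_le hc hε (by linarith) (by omega) hεp hm hu hi t i
    _ = ENNReal.ofReal (∑ t ∈ I, Real.exp (-((i - t : ℕ) / (8 * (d : ℝ) ^ 2)))) :=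
        (ENNReal.ofReal_sum_of_nonneg fun _ _ => (Real.exp_pos _).le).symm
    _ ≤ _ := by
        refine ENNReal.ofReal_le_ofReal ?_
        have h := sum_exp_le hγ hγ1 L i
        have e1 : 2 / (1 / (16 * (d : ℝ) ^ 2)) = 32 * (d : ℝ) ^ 2 := by
          field_simp; norm_num
        have e2 : 1 / (16 * (d : ℝ) ^ 2) * L = L / (16 * (d : ℝ) ^ 2) := by ring
        have e3 : ∀ x : ℝ, 2 * (1 / (16 * (d : ℝ) ^ 2)) * x = x / (8 * (d : ℝ) ^ 2) := by
          intro x; field_simp; ring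
        simpa only [e1, e2, e3] using h

end Window

/-! ### Choice of parameters, with `y = e^k` and `L = y ^ (2 * a + 5)` -/

section Parameters

variable {p d : ℕ} {ε : ℝ}

lemma maxIncrease_le (hε : 0 ≤ ε) (hε1 : ε ≤ 1 / 2) : maxIncrease p ε ≤ 21 * (ε * p) := by
  have h1 : Real.exp (ε * 6) ≤ 21 := by
    calc Real.exp (ε * 6) ≤ Real.exp ((3 : ℕ) * 1) :=
          Real.exp_le_exp.2 (by push_cast; linarith)
      _ = Real.exp 1 ^ 3 := Real.exp_nat_mul 1 3
      _ ≤ 2.7182818286 ^ 3 := by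
          gcongr
          exact Real.exp_one_lt_d9.le
      _ ≤ 21 := by norm_num
  rw [maxIncrease, mul_comm]
  gcongr

lemma plateau_le (hε : 0 < ε) (hε1 : ε ≤ 1 / 2) : plateau p d ε ≤ 84 * (p * d) := by
  rw [plateau, div_le_iff₀ hε]
  have := maxIncrease_le (p := p) hε.le hε1
  calc 4 * maxIncrease p ε * d ≤ 4 * (21 * (ε * p)) * d := by gcongr
    _ = _ := by ring

variable {a : ℕ} {y : ℝ}

lemma seven_mul_plateau_le (hε : 0 < ε) (hε1 : ε ≤ 1 / 2) (hεp : 32 ≤ ε ^ 2 * p)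
    (hy : 128 ≤ y) (hpy : p ≤ y) (hd : (d : ℝ) ≤ 2 * y ^ a) :
    7 * (6 + plateau p d ε / ε) ≤ ε * y ^ (2 * a + 5) := by
  have hy0 : 0 < y := by linarith
  have hp0 : (0 : ℝ) ≤ p := p.cast_nonneg
  have hεy : 1 ≤ ε * y := by nlinarith
  have hinv : 1 / ε ≤ y := by
    rw [div_le_iff₀ hε]
    linarith
  have hya : 1 ≤ y ^ a := one_le_pow₀ (by linarith)
  have h1 : plateau p d ε / ε ≤ 168 * (y ^ 2 * y ^ a) := by
    calc plateau p d ε / ε = plateau p d ε * (1 / ε) := by ring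
      _ ≤ 84 * (y * (2 * y ^ a)) * y := by
          refine mul_le_mul ((plateau_le hε hε1).trans ?_) hinv (by positivity) (by positivity)
          gcongr
      _ = _ := by ring
  have h2 : y ^ 2 * y ^ a * 16384 ≤ y ^ 2 * y ^ a * y ^ 2 := by
    gcongr
    nlinarith
  have h3 : (1 : ℝ) ≤ y ^ 2 * y ^ a := by nlinarith
  have h4 : y ^ 2 * y ^ a * y ^ 2 ≤ ε * y ^ (2 * a + 5) := by
    calc y ^ 2 * y ^ a * y ^ 2 ≤ y ^ 2 * y ^ a * y ^ 2 * (ε * y) * y ^ a := by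
          have h5 : 0 ≤ y ^ 2 * y ^ a * y ^ 2 := by positivity
          refine (le_mul_of_one_le_right h5 hεy).trans ?_
          exact le_mul_of_one_le_right (by positivity) hya
      _ = ε * y ^ (2 * a + 5) := by ring
  linarith

lemma plateau_add_le (hε : 0 < ε) (hε1 : ε ≤ 1 / 2)
    (hy : 128 ≤ y) (hpy : p ≤ y) (hd : (d : ℝ) ≤ 2 * y ^ a) :
    plateau p d ε + maxIncrease p ε * y ^ (2 * a + 5) ≤
      y ^ (2 * a + 8) - Real.exp (ε * 5) := by
  have hy0 : 0 < y := by linarith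
  have hp0 : (0 : ℝ) ≤ p := p.cast_nonneg
  have hya : 1 ≤ y ^ a := one_le_pow₀ (by linarith)
  set z := y ^ (2 * a + 6) with hz
  have hy5 : 1 ≤ y ^ 5 := one_le_pow₀ (by linarith)
  have hz1 : y * y ^ a ≤ z := by
    calc y * y ^ a ≤ y * y ^ a * (y ^ 5 * y ^ a) :=
          le_mul_of_one_le_right (by positivity) (by nlinarith)
      _ = z := by rw [hz]; ring
  have hz2 : 1 ≤ z := one_le_pow₀ (by linarith)
  have h1 : plateau p d ε ≤ 168 * z := by
    calc plateau p d ε ≤ 84 * (y * (2 * y ^ a)) := (plateau_le hε hε1).trans (by gcongr)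
      _ = 168 * (y * y ^ a) := by ring
      _ ≤ 168 * z := by gcongr
  have h2 : maxIncrease p ε * y ^ (2 * a + 5) ≤ 21 * z := by
    calc maxIncrease p ε * y ^ (2 * a + 5) ≤ 21 * (1 * y) * y ^ (2 * a + 5) := by
          gcongr
          refine (maxIncrease_le hε.le hε1).trans ?_
          gcongr
          linarith
      _ = 21 * z := by rw [hz]; ring
  have h3 : Real.exp (ε * 5) ≤ 21 := by
    calc Real.exp (ε * 5) ≤ Real.exp ((3 : ℕ) * 1) :=
          Real.exp_le_exp.2 (by push_cast; linarith)
      _ = Real.exp 1 ^ 3 := Real.exp_nat_mul 1 3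
      _ ≤ 2.7182818286 ^ 3 := by
          gcongr
          exact Real.exp_one_lt_d9.le
      _ ≤ 21 := by norm_num
  have h4 : y ^ (2 * a + 8) = z * y ^ 2 := by rw [hz]; ring
  have h5 : z * 16384 ≤ z * y ^ 2 := by
    gcongr
    nlinarith
  linarith

/-- As `d² ≤ 4 y ^ (2 * a)`, the exponent is at least `2 y`. One factor `e^{-y}` absorbs the
prefactor `d²`, at the price of `(2 * a)!`. -/
lemma tail_le (hd0 : 0 < d) (hy : 128 ≤ y) (hd : (d : ℝ) ≤ 2 * y ^ a) :
    32 * (d : ℝ) ^ 2 * Real.exp (-(y ^ (2 * a + 5) / (16 * (d : ℝ) ^ 2))) ≤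
      128 * ((2 * a).factorial : ℝ) * Real.exp (-y) := by
  have hy0 : 0 < y := by linarith
  have hd' : (0 : ℝ) < d := by exact_mod_cast hd0
  have hd2 : (d : ℝ) ^ 2 ≤ 4 * y ^ (2 * a) := by
    calc (d : ℝ) ^ 2 ≤ (2 * y ^ a) ^ 2 := by gcongr
      _ = 4 * y ^ (2 * a) := by ring
  have h1 : 2 * y ≤ y ^ (2 * a + 5) / (16 * (d : ℝ) ^ 2) := by
    rw [le_div_iff₀ (by positivity)]
    have h2 : (128 : ℝ) ≤ y ^ 4 := by
      calc (128 : ℝ) ≤ 128 ^ 4 := by norm_num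
        _ ≤ y ^ 4 := by gcongr
    calc 2 * y * (16 * (d : ℝ) ^ 2) ≤ 2 * y * (16 * (4 * y ^ (2 * a))) := by gcongr
      _ = y * y ^ (2 * a) * 128 := by ring
      _ ≤ y * y ^ (2 * a) * y ^ 4 := by gcongr
      _ = _ := by ring
  have h3 : y ^ (2 * a) ≤ (2 * a).factorial * Real.exp y := by
    have := Real.pow_div_factorial_le_exp y hy0.le (2 * a)
    rw [div_le_iff₀ (by positivity)] at this
    linarith
  calc 32 * (d : ℝ) ^ 2 * Real.exp (-(y ^ (2 * a + 5) / (16 * (d : ℝ) ^ 2)))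
      ≤ 32 * (4 * ((2 * a).factorial * Real.exp y)) * Real.exp (-(2 * y)) := by
        gcongr
        exact hd2.trans (by gcongr)
    _ = 128 * ((2 * a).factorial : ℝ) * (Real.exp y * Real.exp (-(2 * y))) := by ring
    _ = _ := by
        rw [← Real.exp_add]
        congr 2
        ring

end Parameters

lemma lt_potential_of_lt_backlog {n : ℕ} {ε b : ℝ} (hε : 0 < ε) (hb : 0 ≤ b) {st : State n}
    (h : b / ε < backlog st) : Real.exp b - Real.exp (ε * 5) < potential ε st := by
  -- Without cups the backlog is the supremum of an empty family, which is 0 by convention.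
  have hn : Nonempty (Fin n) := by
    by_contra hn
    rw [not_nonempty_iff] at hn
    rw [backlog, Real.iSup_of_isEmpty] at h
    exact absurd h (not_lt.2 (by positivity))
  obtain ⟨j, hj⟩ := exists_lt_of_lt_ciSup h
  have h1 : bump ε (st.fill j) ≤ potential ε st :=
    Finset.single_le_sum (f := fun j => bump ε (st.fill j)) (fun _ _ => bump_nonneg _)
      (Finset.mem_univ j)
  have h2 : Real.exp b < Real.exp (ε * st.fill j) := by
    rw [Real.exp_lt_exp, mul_comm]
    exact (div_lt_iff₀ hε).1 hj
  have h3 : Real.exp (ε * st.fill j) - Real.exp (ε * 5) ≤ bump ε (st.fill j) := le_max_left _ _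
  linarith

lemma ceil_one_div_bounds {p a : ℕ} {δ : ℝ} (hp : 1 ≤ p) (hδ : 1 / (p : ℝ) ^ a ≤ δ)
    (hδ1 : δ < 1) : 2 ≤ ⌈1 / δ⌉₊ ∧ (⌈1 / δ⌉₊ : ℝ) ≤ 2 * (p : ℝ) ^ a := by
  have hp' : (1 : ℝ) ≤ p := by exact_mod_cast hp
  have hpa : 1 ≤ (p : ℝ) ^ a := one_le_pow₀ hp'
  have hδ0 : 0 < δ := lt_of_lt_of_le (by positivity) hδ
  constructor
  · refine Nat.lt_ceil.2 ?_
    rw [Nat.cast_one]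
    exact (one_lt_div hδ0).2 hδ1
  · have h1 : 1 / δ ≤ (p : ℝ) ^ a := (one_div_le (by positivity) hδ0).1 hδ
    have h2 := Nat.ceil_lt_add_one (one_div_pos.2 hδ0).le
    linarith

end CupGame

end

/-- `c₀`, `C₀` are the constants of the lower bound `Ω(e^{-O(ε² p)})` on `δ`, and `a` is the exponent
of the lower bound `1 / poly(p)`.  If `1/δ` is not an integer, the algorithm is run with
`1 / ⌈1/δ⌉` in the place of `δ`. -/
theorem mainTheorem4 :
    ∃ c₀ C₀ : ℝ, 0 < c₀ ∧ 0 < C₀ ∧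
      ∀ a : ℕ, ∃ B D : ℝ, 0 < B ∧ 0 < D ∧
        ∀ (n p : ℕ) (ε δ : ℝ), 1 ≤ p →
          (p : ℝ) ^ (-(1 / 3) : ℝ) ≤ ε → ε ≤ 1 / 2 →
          1 / (p : ℝ) ^ a ≤ δ → C₀ * Real.exp (-(c₀ * (ε ^ 2 * p))) ≤ δ → δ < 1 →
          ∀ c : ℕ → Fin n → ℝ, CupGame.IsPouring n p ε c →
          ∀ (Ω : Type*) [MeasurableSpace Ω] (μ : Measure Ω) [IsProbabilityMeasure μ]
            (s : Fin n → ℕ → Ω → ℝ),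
            (∀ j m, Measurable (s j m)) →
            (∀ j m, pdf.IsUniform (s j m) (Set.Ioc 0 1) μ volume) →
            iIndepFun (fun q : Fin n × ℕ => s q.1 q.2) μ →
          ∀ S : Ω → ℕ → Finset (Fin n),
            (∀ ω, CupGame.IsSmoothedGreedy p ⌈1 / δ⌉₊ c (fun j m => s j m ω) (S ω)) →
          ∀ (i : ℕ) (k : ℝ), Real.log p ≤ k →
            μ {ω | B * (k / ε) <
                CupGame.backlog
                  (CupGame.state ⌈1 / δ⌉₊ c (fun j m => s j m ω) (S ω) i)} ≤
              ENNReal.ofReal (D * Real.exp (-Real.exp k)) := by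
  -- `C₀ = e^32` is chosen so that `C₀ e^{-ε² p} ≤ δ < 1` forces `ε² p > 32`. The exponent `2 * a +
  -- 8` is the power of `e^k` bounding the potential.
  refine ⟨1, Real.exp 32, one_pos, Real.exp_pos _, fun a =>
    ⟨((2 * a + 8 : ℕ) : ℝ), 128 * ((2 * a).factorial : ℝ), by positivity, by positivity, ?_⟩⟩
  intro n p ε δ hp hεlow hε1 hδlow hδexp hδ1 c hc Ω _ μ _ s hm hu hi S hS i k hk
  have hp0 : (0 : ℝ) < p := by exact_mod_cast hp
  have hε : 0 < ε := lt_of_lt_of_le (Real.rpow_pos_of_pos hp0 _) hεlow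
  have hεp : 32 ≤ ε ^ 2 * p := by
    have h := hδexp.trans_lt hδ1
    rw [← Real.exp_add, Real.exp_lt_one_iff] at h
    linarith
  have hpy : (p : ℝ) ≤ Real.exp k := (Real.log_le_iff_le_exp hp0).1 hk
  -- `32 ≤ ε² p ≤ p / 4`, so `p` is at least 128.
  have hy : 128 ≤ Real.exp k := by
    have hε2 : ε ^ 2 ≤ 1 / 4 := by nlinarith
    nlinarith
  obtain ⟨hd2, hda⟩ := CupGame.ceil_one_div_bounds hp hδlow hδ1
  have hdy : (⌈1 / δ⌉₊ : ℝ) ≤ 2 * Real.exp k ^ a := hda.trans (by gcongr)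
  have hk0 : 0 ≤ k := (Real.log_nonneg (by exact_mod_cast hp)).trans hk
  refine le_trans (measure_mono fun ω hω => ?_) ((CupGame.measure_potential_le hp hc hε hε1 hd2 hεp
    hm hu hi hS i (L := Real.exp k ^ (2 * a + 5)) (by positivity)
    (CupGame.seven_mul_plateau_le hε hε1 hεp hy hpy hdy)).trans
    (ENNReal.ofReal_le_ofReal (CupGame.tail_le (by omega) hy hdy)))
  rw [Set.mem_ofPred_eq, ← mul_div_assoc] at hω
  have h := CupGame.lt_potential_of_lt_backlog hε (by positivity) hω
  rw [Real.exp_nat_mul] at h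
  exact (CupGame.plateau_add_le hε hε1 hy hpy hdy).trans_lt h
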